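/- Let $n\in\mathbb N=\{1,2,\dots\}$, $\gamma\in(0,\infty)$, $p\in[1,\infty)$ and $q\in(0,\infty)$ satisfy $n\left(\frac1p-\frac1q\right)<1$. Then there is a function $C:(0,\infty)\to(0,\infty)$, depending only on $n,\gamma,p,q$, which is continuous and (strictly) increasing and has the following property. Let $X$ be a ball Banach function space on $\mathbb R^n$ such that its convexification $X^{1/p}$, with $\|g\|_{X^{1/p}}:=\|\,|g|^{1/p}\|_X^{p}$, is also a ball Banach function space, and such that the Hardy--Littlewood maximal operator $\mathcal M$ is bounded on the associate space $(X^{1/p})'$, with operator norm $\|\mathcal M\|_{(X^{1/p})'\to(X^{1/p})'}$. Then, for every $f\in C^1(\mathbb R^n)$ with $|\nabla f|\in C_{\mathrm c}(\mathbb R^n)$, $$ \sup_{\lambda\in(0,\infty)}\lambda\left\|\left[\int_{\mathbb R^n}\mathbf 1_{E_{\lambda,\gamma/q}[f]}(\cdot,y)\,|\cdot-y|^{\gamma-n}\,dy\right]^{1/q}\right\|_X\le C\left(\|\mathcal M\|_{(X^{1/p})'\to(X^{1/p})'}\right)\big\|\,|\nabla f|\,\big\|_X, $$ where $$ E_{\lambda,\gamma/q}[f]:=\left\{(x,y)\in\mathbb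 R^n\times\mathbb R^n:\ x\ne y,\ \frac{|f(x)-f(y)|}{|x-y|^{1+\gamma/q}}>\lambda\right\}. $$ (Boundedness of $\mathcal M$ on $X$ itself is not assumed.) Here a ball Banach function space is a Banach space $X$ of (complex-valued) measurable functions on $\mathbb R^n$, with a norm $\|\cdot\|_X$ that makes sense (possibly infinite) for all measurable functions, such that, for all measurable $f,g,f_m$ and all balls $B$: (i) $\|f\|_X=0$ implies $f=0$ almost everywhere; (ii) $|g|\le|f|$ almost everywhere implies $\|g\|_X\le\|f\|_X$; (iii) $0\le f_m\uparrow f$ almost everywhere implies $\|f_m\|_X\uparrow\|f\|_X$; (iv) $\mathbf 1_B\in X$; (v) there is a positive constant $C_{(B)}$ such that $\int_B|h(x)|\,dx\le C_{(B)}\|h\|_X$ for all $h\in X$. The associate space $Y'$ of $Y$ consists of all measurable $f$ with $\|f\|_{Y'}:=\sup\{\|fg\|_{L^1(\mathbb R^n)}:\ g\in Y,\ \|g\|_Y=1\}<\infty$, and $\mathcal M(f)(x):=\sup_{B\ni x}\frac1{|B|}\int_B|f(y)|\,dy$, the supremum being taken over all balls $B$ containing $x$. -/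

import Mathlib

open MeasureTheory Filter Topology
open scoped ENNReal NNReal

namespace BVY

noncomputable section

/-- A function space on `ℝⁿ` is given by its extended (quasi-)norm, defined for all functions and
relevant on (Lebesgue) measurable ones only: `f` belongs to the space `X` if and only if `f` is
measurable and `X f < ∞`. -/
abbrev FunctionNorm (n : ℕ) : Type := (EuclideanSpace ℝ (Fin n) → ℂ) → ℝ≥0∞

variable {n : ℕ}

/-- `f ∈ X`. Almost everywhere measurability for the Borel Lebesgue measure is the same thing as
Lebesgue measurability. -/
def Mem (X : FunctionNorm n) (f : EuclideanSpace ℝ (Fin n) → ℂ) : Prop :=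
  AEMeasurable f ∧ X f < ∞

/-- Ball quasi-Banach function spaces. -/
structure IsBallQuasiBanach (X : FunctionNorm n) : Prop where
  /-- homogeneity of the quasi-norm -/
  smul : ∀ (c : ℂ) (f : EuclideanSpace ℝ (Fin n) → ℂ), Mem X f →
    X (fun x => c * f x) = ‖c‖ₑ * X f
  /-- the quasi-triangle inequality -/
  quasi_add : ∃ K : ℝ≥0, 1 ≤ K ∧ ∀ f g : EuclideanSpace ℝ (Fin n) → ℂ,
    Mem X f → Mem X g → X (fun x => f x + g x) ≤ K * (X f + X g)
  /-- completeness -/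
  complete : ∀ u : ℕ → EuclideanSpace ℝ (Fin n) → ℂ, (∀ k, Mem X (u k)) →
    (∀ ε : ℝ≥0∞, 0 < ε → ∃ N : ℕ, ∀ k ≥ N, ∀ l ≥ N, X (fun x => u k x - u l x) < ε) →
    ∃ f, Mem X f ∧ Tendsto (fun k => X (fun x => u k x - f x)) atTop (𝓝 0)
  /-- if `‖f‖_X = 0`, then `f = 0` almost everywhere -/
  eq_zero : ∀ f : EuclideanSpace ℝ (Fin n) → ℂ, AEMeasurable f → X f = 0 →
    ∀ᵐ x, f x = 0
  /-- the lattice property -/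
  lattice : ∀ f g : EuclideanSpace ℝ (Fin n) → ℂ, AEMeasurable f → AEMeasurable g →
    (∀ᵐ x, ‖g x‖ ≤ ‖f x‖) → X g ≤ X f
  /-- the Fatou property: if `0 ≤ u m ↑ f` almost everywhere, then `‖u m‖_X ↑ ‖f‖_X`
  (that the norms increase is part of the lattice property) -/
  fatou : ∀ (u : ℕ → EuclideanSpace ℝ (Fin n) → ℝ) (f : EuclideanSpace ℝ (Fin n) → ℝ),
    (∀ m, AEMeasurable (u m)) → AEMeasurable f →
    (∀ᵐ x, (∀ m, 0 ≤ u m x) ∧ Monotone (fun m => u m x) ∧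
      Tendsto (fun m => u m x) atTop (𝓝 (f x))) →
    Tendsto (fun m => X (fun x => (u m x : ℂ))) atTop (𝓝 (X (fun x => (f x : ℂ))))
  /-- characteristic functions of balls belong to `X` -/
  ball_mem : ∀ (c : EuclideanSpace ℝ (Fin n)) (r : ℝ), 0 < r →
    Mem X ((Metric.ball c r).indicator (fun _ => (1 : ℂ)))

/-- Ball Banach function spaces. -/
structure IsBallBanach (X : FunctionNorm n) : Prop extends IsBallQuasiBanach X where
  /-- the triangle inequality -/
  add : ∀ f g : EuclideanSpace ℝ (Fin n) → ℂ, Mem X f → Mem X g →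
    X (fun x => f x + g x) ≤ X f + X g
  /-- elements of `X` are integrable on balls, with control by the norm -/
  integral_ball : ∀ (c : EuclideanSpace ℝ (Fin n)) (r : ℝ), 0 < r →
    ∃ K : ℝ≥0, 0 < K ∧ ∀ f : EuclideanSpace ℝ (Fin n) → ℂ, Mem X f →
      ∫⁻ x in Metric.ball c r, ‖f x‖ₑ ≤ K * X f

/-- The `s`-convexification `X^s`: `‖f‖_{X^s} = ‖ |f|^s ‖_X^{1/s}`. -/
def convexification (X : FunctionNorm n) (s : ℝ) : FunctionNorm n :=
  fun f => X (fun x => ((‖f x‖ ^ s : ℝ) : ℂ)) ^ (1 / s)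

/-- The associate space (Köthe dual) `X'`: the supremum of `‖f g‖_{L¹}` over `‖g‖_X = 1`. -/
def associate (X : FunctionNorm n) : FunctionNorm n :=
  fun f => ⨆ (g : EuclideanSpace ℝ (Fin n) → ℂ) (_ : Mem X g) (_ : X g = 1),
    ∫⁻ x, ‖f x * g x‖ₑ

open Classical in
/-- The norm in `X` of a function with values in `[0, ∞]`: it is infinite if the function is
infinite on a set of positive measure (such a function does not belong to `X`). -/
def normENN (X : FunctionNorm n) (h : EuclideanSpace ℝ (Fin n) → ℝ≥0∞) : ℝ≥0∞ :=
  if ∀ᵐ x, h x < ∞ then X (fun x => ((h x).toReal : ℂ)) else ∞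

/-- The (uncentred) Hardy--Littlewood maximal function. -/
def maximalFn (g : EuclideanSpace ℝ (Fin n) → ℂ) (x : EuclideanSpace ℝ (Fin n)) : ℝ≥0∞ :=
  ⨆ (c : EuclideanSpace ℝ (Fin n)) (r : ℝ) (_ : 0 < r) (_ : x ∈ Metric.ball c r),
    (∫⁻ y in Metric.ball c r, ‖g y‖ₑ) / volume (Metric.ball c r)

/-- `‖𝓜 g‖_Y ≤ A ‖g‖_Y` for all `g ∈ Y`. -/
def MaximalBoundedBy (Y : FunctionNorm n) (A : ℝ≥0) : Prop :=
  ∀ g : EuclideanSpace ℝ (Fin n) → ℂ, Mem Y g → normENN Y (maximalFn g) ≤ A * Y g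

/-- The Hardy--Littlewood maximal operator is bounded on `Y`. -/
def MaximalBounded (Y : FunctionNorm n) : Prop :=
  ∃ A : ℝ≥0, MaximalBoundedBy Y A

/-- The operator norm `‖𝓜‖_{Y → Y}` (meaningful if `𝓜` is bounded on `Y`). -/
def maximalOpNorm (Y : FunctionNorm n) : ℝ≥0 :=
  sInf {A : ℝ≥0 | MaximalBoundedBy Y A}

/-- `|∇f|`, the Euclidean length of the gradient `(∂₁f, …, ∂ₙf)`. -/
def gradNorm (f : EuclideanSpace ℝ (Fin n) → ℂ) (x : EuclideanSpace ℝ (Fin n)) : ℝ :=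
  √(∑ j : Fin n, ‖fderiv ℝ f x (EuclideanSpace.single j 1)‖ ^ 2)

/-- `E_{l, b}[f] = {(x, y) : x ≠ y, |f(x) - f(y)| / |x - y|^{1 + b} > l}`. -/
def levelSet (f : EuclideanSpace ℝ (Fin n) → ℂ) (l b : ℝ) :
    Set (EuclideanSpace ℝ (Fin n) × EuclideanSpace ℝ (Fin n)) :=
  {z | z.1 ≠ z.2 ∧ l < ‖f z.1 - f z.2‖ / ‖z.1 - z.2‖ ^ (1 + b)}

/-- `x ↦ [∫ 1_{E_{l, γ/q}[f]}(x, y) |x - y|^{γ - n} dy]^{1/q}`. -/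
def bvyFn (f : EuclideanSpace ℝ (Fin n) → ℂ) (γ q l : ℝ) (x : EuclideanSpace ℝ (Fin n)) :
    ℝ≥0∞ :=
  (∫⁻ y, (levelSet f l (γ / q)).indicator
    (fun z => ENNReal.ofReal (‖z.1 - z.2‖ ^ (γ - n))) (x, y)) ^ (1 / q)

end

end BVY

namespace BVY

/-! The estimate is first proved in weighted `L^p` for weights `ω` with `Mω ≤ Aω` everywhere, with a
constant `K A²`, and then extrapolated to `X` by duality.

Weighted estimate, `p ≤ q`. Put `b = γ/q` and `r = |x - y|`. Averaging the fundamental theorem of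
calculus over a ball halfway between `x` and `y` bounds `|f(x) - f(y)|` by `2^n r` times integrals
over `t ∈ (0,1)` of averages of `|∇f|` on the balls of radius `t r` about `x` and `y`. If `(x, y)`
lies in the level set, one such average, at a scale `t ~ 2^{-j}`, is therefore at least `c λ
2^{j(1-δ+b)} ρ^b` with `ρ = t r` (`exists_large_ballAvg`). For each `j`, Vitali's lemma selects
disjoint balls `B` with such large averages whose fivefold enlargements catch `x` or `y`, while `r`
is at most a multiple of `2^j` times the radius of `B`. The kernel restricted to these pairs is
`localPart`. Hölder's inequality and the weight condition bound its contribution by `K A²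
2^{j(n(1-s)+γs)} ρ^{γs} |B| ω(x)` for every `x ∈ B`, where `s = p/q`
(`exists_lintegral_localPart_le`); the lower bound on the average then turns this into a multiple of
`∫_B |∇f|^p ω`. Disjointness sums the balls, and the hypothesis `n(1/p - 1/q) < 1` makes the series
over `j` geometric.

If `q < p`, a splitting of the kernel at an optimal radius reduces to `q = p` without changing the
level set (`exists_bvyFn_le_mul_bvyFn`).

Extrapolation. Let `Y = X^{1/p}`. Rubio de Francia's iteration puts below every `φ` in the unit ball
of `Y'` a weight of the above kind with norm at most 2 (`exists_weight_ge`). Hence the `p`-th power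
of the functional pairs with `φ` to at most a constant times `‖|∇f|‖_X^p`, and the
Lorentz--Luxemburg theorem, obtained from Hahn--Banach separation in `L²`, recovers the norm in `Y`
from these pairings. -/

/-- The uncentred Hardy--Littlewood maximal function of a function with values in `[0, ∞]`. -/
noncomputable def maxAvg {n : ℕ} (h : EuclideanSpace ℝ (Fin n) → ℝ≥0∞)
    (x : EuclideanSpace ℝ (Fin n)) : ℝ≥0∞ :=
  ⨆ (c : EuclideanSpace ℝ (Fin n)) (r : ℝ) (_ : 0 < r) (_ : x ∈ Metric.ball c r),
    (∫⁻ y in Metric.ball c r, h y) / volume (Metric.ball c r)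

/-! ### Elementary properties of the maximal function. -/

section MaxAvg

variable {n : ℕ} {h h₁ h₂ : EuclideanSpace ℝ (Fin n) → ℝ≥0∞}

theorem maximalFn_eq_maxAvg (g : EuclideanSpace ℝ (Fin n) → ℂ) :
    maximalFn g = maxAvg (fun x => ‖g x‖ₑ) := rfl

theorem setLIntegral_ball_le_maxAvg {c x : EuclideanSpace ℝ (Fin n)} {r : ℝ} (hr : 0 < r)
    (hx : x ∈ Metric.ball c r) :
    ∫⁻ y in Metric.ball c r, h y ≤ maxAvg h x * volume (Metric.ball c r) := by
  have h0 : volume (Metric.ball c r) ≠ 0 := (Metric.measure_ball_pos volume c hr).ne'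
  have ht : volume (Metric.ball c r) ≠ ∞ := measure_ball_lt_top.ne
  rw [← ENNReal.div_le_iff h0 ht]
  exact le_iSup₂_of_le c r (le_iSup₂_of_le hr hx le_rfl)

theorem maxAvg_congr_ae (hh : h₁ =ᵐ[volume] h₂) : maxAvg h₁ = maxAvg h₂ := by
  have (s : Set (EuclideanSpace ℝ (Fin n))) : ∫⁻ y in s, h₁ y = ∫⁻ y in s, h₂ y :=
    lintegral_congr_ae (ae_restrict_of_ae hh)
  funext x
  simp only [maxAvg, this]

theorem maxAvg_const_mul (a : ℝ≥0∞) (ha : a ≠ ∞) (x : EuclideanSpace ℝ (Fin n)) :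
    maxAvg (fun y => a * h y) x = a * maxAvg h x := by
  simp only [maxAvg, ENNReal.mul_iSup, lintegral_const_mul' _ _ ha, mul_div_assoc]

theorem maxAvg_tsum_le {ι : Type*} [Countable ι] {u : ι → EuclideanSpace ℝ (Fin n) → ℝ≥0∞}
    (hu : ∀ i, AEMeasurable (u i)) (x : EuclideanSpace ℝ (Fin n)) :
    maxAvg (fun y => ∑' i, u i y) x ≤ ∑' i, maxAvg (u i) x := by
  refine iSup₂_le fun c r => iSup₂_le fun hr hx => ?_
  rw [lintegral_tsum fun i => (hu i).restrict, div_eq_mul_inv, ← ENNReal.tsum_mul_right]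
  exact ENNReal.tsum_le_tsum fun i => le_iSup₂_of_le c r (le_iSup₂_of_le hr hx le_rfl)

theorem maxAvg_one_le (x : EuclideanSpace ℝ (Fin n)) : maxAvg (fun _ => 1) x ≤ 1 :=
  iSup₂_le fun c r => iSup₂_le fun _ _ => by
    rw [setLIntegral_one]
    exact ENNReal.div_self_le_one

/-- Superlevel sets of the uncentred maximal function are unions of open balls, so no measurability
of `h` is needed. -/
theorem measurable_maxAvg : Measurable (maxAvg h) := by
  refine measurable_of_Ioi fun a => IsOpen.measurableSet ?_
  have : maxAvg h ⁻¹' Set.Ioi a =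
      ⋃ (c : EuclideanSpace ℝ (Fin n)) (r : ℝ) (_ : 0 < r)
        (_ : a < (∫⁻ y in Metric.ball c r, h y) / volume (Metric.ball c r)), Metric.ball c r := by
    ext x
    simp only [maxAvg, Set.mem_preimage, Set.mem_Ioi, lt_iSup_iff, Set.mem_iUnion]
    grind
  rw [this]
  exact isOpen_iUnion fun c => isOpen_iUnion fun r => isOpen_iUnion fun _ =>
    isOpen_iUnion fun _ => Metric.isOpen_ball

end MaxAvg

/-! ### Riesz type kernels on balls. -/

theorem volume_ball_eq {n : ℕ} (x : EuclideanSpace ℝ (Fin n)) {r : ℝ} (hr : 0 < r) :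
    volume (Metric.ball x r) =
      ENNReal.ofReal (r ^ n) * volume (Metric.ball (0 : EuclideanSpace ℝ (Fin n)) 1) := by
  rw [Measure.addHaar_ball_of_pos _ _ hr, finrank_euclideanSpace_fin]

theorem rpow_le_of_half_le {d ρ : ℝ} (a : ℝ) (hρ : 0 < ρ) (h1 : ρ / 2 ≤ d) (h2 : d ≤ ρ) :
    d ^ a ≤ 2 ^ |a| * ρ ^ a := by
  have hd : 0 < d := by linarith
  have h2' : (1 : ℝ) ≤ 2 ^ |a| := Real.one_le_rpow (by norm_num) (abs_nonneg a)
  rcases le_or_gt 0 a with ha | ha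
  · calc d ^ a ≤ ρ ^ a := Real.rpow_le_rpow hd.le h2 ha
      _ ≤ 2 ^ |a| * ρ ^ a := le_mul_of_one_le_left (by positivity) h2'
  · calc d ^ a ≤ (ρ / 2) ^ a := Real.rpow_le_rpow_of_nonpos (by positivity) h1 ha.le
      _ = 2 ^ |a| * ρ ^ a := by
        rw [abs_of_neg ha, Real.div_rpow hρ.le (by norm_num), Real.rpow_neg (by norm_num)]
        field_simp

/-- Integration of a Riesz type kernel on a ball against a weight. -/
theorem setLIntegral_ball_kernel_le (n : ℕ) {γ : ℝ} (hγ : 0 < γ) :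
    ∃ K : ℝ≥0, ∀ (ω : EuclideanSpace ℝ (Fin n) → ℝ≥0∞), Measurable ω →
      ∀ (y : EuclideanSpace ℝ (Fin n)) (R : ℝ), 0 < R →
      ∫⁻ x in Metric.ball y R, ENNReal.ofReal (‖x - y‖ ^ (γ - n)) * ω x ≤
        K * ENNReal.ofReal (R ^ γ) * maxAvg ω y := by
  set V := volume (Metric.ball (0 : EuclideanSpace ℝ (Fin n)) 1) with hV
  have hVt : V ≠ ∞ := measure_ball_lt_top.ne
  set k : ℝ≥0∞ := ENNReal.ofReal (2 ^ |γ - n| * 2 ^ n) * V *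
    (1 - ENNReal.ofReal ((1 / 2) ^ γ))⁻¹ with hk
  have hkt : k ≠ ∞ := by
    refine ENNReal.mul_ne_top (ENNReal.mul_ne_top ENNReal.ofReal_ne_top hVt) ?_
    rw [ENNReal.inv_ne_top]
    have : ENNReal.ofReal ((1 / 2) ^ γ) < 1 := by
      rw [ENNReal.ofReal_lt_one]
      exact Real.rpow_lt_one (by norm_num) (by norm_num) hγ
    exact (tsub_pos_of_lt this).ne'
  refine ⟨k.toNNReal, fun ω hω y R hR => ?_⟩
  rw [ENNReal.coe_toNNReal hkt]
  -- Decompose the ball into dyadic annuli. On the annulus of outer radius `ρ m` the kernel is about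
  -- `ρ m ^ (γ - n)`, and the weight integrates to at most `maxAvg ω y` times a multiple of `ρ m ^
  -- n`. The products form a geometric series of ratio `2^(-γ)`, whose sum is the last factor of
  -- `k`.
  set ρ : ℕ → ℝ := fun m => (1 / 2) ^ m * R with hρ
  have hρ0 : ∀ m, 0 < ρ m := fun m => by positivity
  have key : ∀ x ∈ Metric.ball y R, ENNReal.ofReal (‖x - y‖ ^ (γ - n)) * ω x ≤
      ∑' m, (Metric.ball y (2 * ρ m)).indicator
        (fun x => ENNReal.ofReal (2 ^ |γ - n| * ρ m ^ (γ - n)) * ω x) x := by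
    intro x hx
    rw [mem_ball_iff_norm] at hx
    have : ∃ m, x ∈ Metric.ball y (2 * ρ m) ∧
        ‖x - y‖ ^ (γ - n) ≤ 2 ^ |γ - n| * ρ m ^ (γ - n) := by
      rcases eq_or_ne x y with rfl | hxy
      -- On the diagonal the kernel is `0 ^ (γ - n)`, which is `1` if `γ = n` and `0` otherwise, so
      -- the outermost annulus serves.
      · refine ⟨0, Metric.mem_ball_self (by have := hρ0 0; positivity), ?_⟩
        rcases eq_or_ne (γ - n) 0 with h0 | h0
        · simp [h0]
        · rw [sub_self, norm_zero, Real.zero_rpow h0]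
          have := hρ0 0
          positivity
      · have hd : 0 < ‖x - y‖ := norm_pos_iff.2 (sub_ne_zero.2 hxy)
        obtain ⟨m, hm1, hm2⟩ := exists_nat_pow_near_of_lt_one (x := ‖x - y‖ / R)
          (y := (1 / 2 : ℝ)) (by positivity) ((div_le_one hR).2 hx.le) (by norm_num)
          (by norm_num)
        rw [lt_div_iff₀ hR] at hm1
        rw [div_le_iff₀ hR] at hm2
        refine ⟨m, ?_, rpow_le_of_half_le _ (hρ0 m) ?_ hm2⟩
        · rw [mem_ball_iff_norm]
          have := hρ0 m
          have h3 : ‖x - y‖ ≤ ρ m := hm2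
          linarith
        · have : ρ m / 2 = (1 / 2) ^ (m + 1) * R := by simp only [hρ]; ring
          linarith
    obtain ⟨m, hm1, hm2⟩ := this
    refine le_trans ?_ (ENNReal.le_tsum m)
    rw [Set.indicator_of_mem hm1]
    gcongr
  calc ∫⁻ x in Metric.ball y R, ENNReal.ofReal (‖x - y‖ ^ (γ - n)) * ω x
      ≤ ∫⁻ x in Metric.ball y R, ∑' m, (Metric.ball y (2 * ρ m)).indicator
        (fun x => ENNReal.ofReal (2 ^ |γ - n| * ρ m ^ (γ - n)) * ω x) x :=
        setLIntegral_mono' measurableSet_ball key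
    _ ≤ ∫⁻ x, ∑' m, (Metric.ball y (2 * ρ m)).indicator
        (fun x => ENNReal.ofReal (2 ^ |γ - n| * ρ m ^ (γ - n)) * ω x) x :=
        setLIntegral_le_lintegral _ _
    _ = ∑' m, ENNReal.ofReal (2 ^ |γ - n| * ρ m ^ (γ - n)) *
          ∫⁻ x in Metric.ball y (2 * ρ m), ω x := by
        rw [lintegral_tsum fun m =>
          ((hω.const_mul _).indicator measurableSet_ball).aemeasurable]
        congr! 2 with m
        rw [lintegral_indicator measurableSet_ball, lintegral_const_mul _ hω]
    _ ≤ ∑' m, ENNReal.ofReal (2 ^ |γ - n| * 2 ^ n) * V * ENNReal.ofReal (R ^ γ) * maxAvg ω y *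
          ENNReal.ofReal ((1 / 2) ^ γ) ^ m := by
        refine ENNReal.tsum_le_tsum fun m => ?_
        have h2 : 0 < 2 * ρ m := by have := hρ0 m; positivity
        calc _ ≤ ENNReal.ofReal (2 ^ |γ - n| * ρ m ^ (γ - n)) *
              (maxAvg ω y * (ENNReal.ofReal ((2 * ρ m) ^ n) * V)) := by
              rw [hV, ← volume_ball_eq y h2]
              gcongr
              exact setLIntegral_ball_le_maxAvg h2 (Metric.mem_ball_self h2)
          _ = ENNReal.ofReal (2 ^ |γ - n| * ρ m ^ (γ - n)) * ENNReal.ofReal ((2 * ρ m) ^ n)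
              * V * maxAvg ω y := by ring
          _ = ENNReal.ofReal (2 ^ |γ - n| * 2 ^ n) * ENNReal.ofReal (R ^ γ) *
              ENNReal.ofReal ((1 / 2) ^ γ) ^ m * V * maxAvg ω y := by
              congr 2
              rw [← ENNReal.ofReal_pow (by positivity), ← ENNReal.ofReal_mul (by positivity),
                ← ENNReal.ofReal_mul (by positivity),
                ← ENNReal.ofReal_mul (by positivity)]
              congr 1
              have e1 : ρ m ^ (γ - n) * ρ m ^ n = ρ m ^ γ := by
                rw [← Real.rpow_natCast, ← Real.rpow_add (hρ0 m)]
                congr 1; ring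
              have e2 : ρ m ^ γ = ((1 / 2) ^ γ) ^ m * R ^ γ := by
                simp only [hρ]
                rw [Real.mul_rpow (by positivity) hR.le, ← Real.rpow_natCast,
                  ← Real.rpow_natCast, ← Real.rpow_mul (by norm_num),
                  ← Real.rpow_mul (by norm_num), mul_comm γ]
              calc _ = 2 ^ |γ - n| * 2 ^ n * (ρ m ^ (γ - n) * ρ m ^ n) := by
                    rw [mul_pow]; ring
                _ = _ := by rw [e1, e2]; ring
          _ = _ := by ring
    _ = k * ENNReal.ofReal (R ^ γ) * maxAvg ω y := by
        rw [ENNReal.tsum_mul_left, ENNReal.tsum_geometric, hk]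
        ring

/-! ### Differences of a function and averages of its gradient. -/

/-- The average of a function over an open ball. -/
noncomputable def ballAvg {n : ℕ} (G : EuclideanSpace ℝ (Fin n) → ℝ≥0∞)
    (z : EuclideanSpace ℝ (Fin n)) (ρ : ℝ) : ℝ≥0∞ :=
  (∫⁻ y in Metric.ball z ρ, G y) / volume (Metric.ball z ρ)

section Gradient

variable {n : ℕ} {f : EuclideanSpace ℝ (Fin n) → ℂ}

theorem gradNorm_nonneg (x : EuclideanSpace ℝ (Fin n)) : 0 ≤ gradNorm f x := Real.sqrt_nonneg _

theorem norm_fderiv_apply_le_gradNorm (x v : EuclideanSpace ℝ (Fin n)) :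
    ‖fderiv ℝ f x v‖ ≤ gradNorm f x * ‖v‖ := by
  have hv : v = ∑ j, v j • EuclideanSpace.single j (1 : ℝ) := by
    have := (EuclideanSpace.basisFun (Fin n) ℝ).sum_repr v
    simpa using this.symm
  calc ‖fderiv ℝ f x v‖
      = ‖∑ j, v j • fderiv ℝ f x (EuclideanSpace.single j (1 : ℝ))‖ := by
        conv_lhs => rw [hv, map_sum]
        simp only [map_smul]
    _ ≤ ∑ j, ‖fderiv ℝ f x (EuclideanSpace.single j (1 : ℝ))‖ * ‖v j‖ := by
        refine (norm_sum_le _ _).trans_eq ?_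
        simp only [norm_smul, mul_comm]
    _ ≤ gradNorm f x * ‖v‖ := by
        rw [EuclideanSpace.norm_eq]
        exact Real.sum_mul_le_sqrt_mul_sqrt _ _ _

theorem continuous_gradNorm (hf : ContDiff ℝ 1 f) : Continuous (gradNorm f) := by
  have := hf.continuous_fderiv one_ne_zero
  unfold gradNorm
  fun_prop

theorem enorm_sub_le_lintegral_gradNorm (hf : ContDiff ℝ 1 f) (x w : EuclideanSpace ℝ (Fin n)) :
    ‖f w - f x‖ₑ ≤
      ∫⁻ t in Set.Ioo (0 : ℝ) 1, ENNReal.ofReal (gradNorm f (x + t • (w - x))) * ‖w - x‖ₑ := by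
  have hg : ContDiff ℝ 1 (fun t : ℝ => f (x + t • (w - x))) := by fun_prop
  have h1 := enorm_sub_le_lintegral_deriv_of_contDiffOn_Icc
    (hg.contDiffOn (s := Set.Icc (0 : ℝ) 1)) zero_le_one
  simp only [one_smul, zero_smul, add_zero, add_sub_cancel] at h1
  refine h1.trans ?_
  rw [restrict_Ioo_eq_restrict_Icc]
  refine lintegral_mono fun t => ?_
  have hd : HasDerivAt (fun t : ℝ => f (x + t • (w - x)))
      (fderiv ℝ f (x + t • (w - x)) (w - x)) t := by
    have h2 : HasDerivAt (fun t : ℝ => x + t • (w - x)) (w - x) t := by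
      simpa using ((hasDerivAt_id t).smul_const (w - x)).const_add x
    exact ((hf.differentiable one_ne_zero) _).hasFDerivAt.comp_hasDerivAt t h2
  rw [hd.deriv, ← ofReal_norm, ← ofReal_norm, ← ENNReal.ofReal_mul (gradNorm_nonneg _)]
  exact ENNReal.ofReal_le_ofReal (norm_fderiv_apply_le_gradNorm _ _)

theorem lintegral_comp_homothety {H : EuclideanSpace ℝ (Fin n) → ℝ≥0∞} (hH : Measurable H)
    (x : EuclideanSpace ℝ (Fin n)) {t : ℝ} (ht : 0 < t) :
    ∫⁻ w, H (x + t • (w - x)) = ENNReal.ofReal ((t ^ n)⁻¹) * ∫⁻ w, H w := by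
  rw [lintegral_sub_right_eq_self (fun w => H (x + t • w)) x]
  have h1 : ∫⁻ w, H (x + t • w) = ∫⁻ w, H (x + w) ∂(Measure.map (t • ·) volume) := by
    rw [lintegral_map (f := fun w => H (x + w)) (hH.comp (measurable_const_add x))
      (measurable_const_smul t)]
  rw [h1, Measure.map_addHaar_smul _ ht.ne', lintegral_smul_measure,
    lintegral_add_left_eq_self H x, finrank_euclideanSpace_fin, abs_of_pos (by positivity),
    smul_eq_mul]

/-- The homothety of centre `x` and ratio `t` carries one ball onto the other, and its Jacobian is
the ratio of their volumes. -/
theorem setLIntegral_ball_comp_homothety {G : EuclideanSpace ℝ (Fin n) → ℝ≥0∞}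
    (hG : Measurable G) (x : EuclideanSpace ℝ (Fin n)) {t r : ℝ} (ht : 0 < t) (hr : 0 < r) :
    ∫⁻ w in Metric.ball x r, G (x + t • (w - x)) =
      volume (Metric.ball x r) * ballAvg G x (t * r) := by
  have h1 : ∀ w, (Metric.ball x r).indicator (fun w => G (x + t • (w - x))) w =
      (Metric.ball x (t * r)).indicator G (x + t • (w - x)) := by
    intro w
    have : w ∈ Metric.ball x r ↔ x + t • (w - x) ∈ Metric.ball x (t * r) := by
      rw [mem_ball_iff_norm, mem_ball_iff_norm, add_sub_cancel_left, norm_smul,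
        Real.norm_of_nonneg ht.le, mul_lt_mul_iff_right₀ ht]
    by_cases hw : w ∈ Metric.ball x r
    · rw [Set.indicator_of_mem hw, Set.indicator_of_mem (this.1 hw)]
    · rw [Set.indicator_of_notMem hw, Set.indicator_of_notMem (mt this.2 hw)]
  rw [← lintegral_indicator measurableSet_ball, lintegral_congr h1,
    lintegral_comp_homothety (hG.indicator measurableSet_ball) x ht,
    lintegral_indicator measurableSet_ball, ballAvg, volume_ball_eq x hr,
    volume_ball_eq x (mul_pos ht hr)]
  set V := volume (Metric.ball (0 : EuclideanSpace ℝ (Fin n)) 1)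
  have hV0 : V ≠ 0 := (Metric.measure_ball_pos volume _ one_pos).ne'
  have hVt : V ≠ ∞ := measure_ball_lt_top.ne
  have h2 : ENNReal.ofReal ((t ^ n)⁻¹) =
      ENNReal.ofReal (r ^ n) * V * (ENNReal.ofReal ((t * r) ^ n) * V)⁻¹ := by
    rw [ENNReal.mul_inv (Or.inr hVt) (Or.inr hV0)]
    calc _ = ENNReal.ofReal (r ^ n) * (ENNReal.ofReal ((t * r) ^ n))⁻¹ := by
          rw [← ENNReal.ofReal_inv_of_pos (by positivity), ← ENNReal.ofReal_mul (by positivity),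
            mul_pow]
          congr 1
          field_simp
      _ = ENNReal.ofReal (r ^ n) * (ENNReal.ofReal ((t * r) ^ n))⁻¹ * (V * V⁻¹) := by
          rw [ENNReal.mul_inv_cancel hV0 hVt, mul_one]
      _ = _ := by ring
  rw [h2, div_eq_mul_inv]
  ring

/-- Integrate the fundamental theorem of calculus along the segments issuing from `x` and exchange
the integrals: at parameter `t` the points of the segments sweep out the ball of radius `t * r`. -/
theorem setLIntegral_ball_enorm_sub_le (hf : ContDiff ℝ 1 f) (x : EuclideanSpace ℝ (Fin n))
    {r : ℝ} (hr : 0 < r) :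
    ∫⁻ w in Metric.ball x r, ‖f w - f x‖ₑ ≤
      volume (Metric.ball x r) * ENNReal.ofReal r *
        ∫⁻ t in Set.Ioo (0 : ℝ) 1, ballAvg (fun y => ENNReal.ofReal (gradNorm f y)) x (t * r) := by
  have hG : Measurable (fun y => ENNReal.ofReal (gradNorm f y)) :=
    (continuous_gradNorm hf).measurable.ennreal_ofReal
  calc ∫⁻ w in Metric.ball x r, ‖f w - f x‖ₑ
      ≤ ∫⁻ w in Metric.ball x r, ∫⁻ t in Set.Ioo (0 : ℝ) 1,
          ENNReal.ofReal (gradNorm f (x + t • (w - x))) * ENNReal.ofReal r := by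
        refine setLIntegral_mono' measurableSet_ball fun w hw => ?_
        refine (enorm_sub_le_lintegral_gradNorm hf x w).trans (lintegral_mono fun t => ?_)
        rw [mem_ball_iff_norm] at hw
        rw [← ofReal_norm]
        gcongr
    _ = ∫⁻ t in Set.Ioo (0 : ℝ) 1, ∫⁻ w in Metric.ball x r,
          ENNReal.ofReal (gradNorm f (x + t • (w - x))) * ENNReal.ofReal r := by
        refine lintegral_lintegral_swap (Measurable.aemeasurable ?_)
        refine Measurable.mul_const ?_ _
        exact hG.comp (by fun_prop)
    _ = ∫⁻ t in Set.Ioo (0 : ℝ) 1, volume (Metric.ball x r) * ENNReal.ofReal r *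
          ballAvg (fun y => ENNReal.ofReal (gradNorm f y)) x (t * r) := by
        refine setLIntegral_congr_fun measurableSet_Ioo fun t ht => ?_
        rw [lintegral_mul_const' _ _ ENNReal.ofReal_ne_top,
          setLIntegral_ball_comp_homothety hG x ht.1 hr]
        ring
    _ = _ := lintegral_const_mul' _ _
        (ENNReal.mul_ne_top measure_ball_lt_top.ne ENNReal.ofReal_ne_top)

/-- A pointwise bound for differences of a function by averages of its gradient. -/
theorem enorm_sub_le_lintegral_ballAvg (hf : ContDiff ℝ 1 f) {x y : EuclideanSpace ℝ (Fin n)}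
    (hxy : x ≠ y) :
    ‖f x - f y‖ₑ ≤ 2 ^ n * ENNReal.ofReal ‖x - y‖ *
      ((∫⁻ t in Set.Ioo (0 : ℝ) 1,
          ballAvg (fun z => ENNReal.ofReal (gradNorm f z)) x (t * ‖x - y‖)) +
        ∫⁻ t in Set.Ioo (0 : ℝ) 1,
          ballAvg (fun z => ENNReal.ofReal (gradNorm f z)) y (t * ‖x - y‖)) := by
  set r := ‖x - y‖ with hrdef
  have hr : 0 < r := norm_pos_iff.2 (sub_ne_zero.2 hxy)
  set V := volume (Metric.ball (0 : EuclideanSpace ℝ (Fin n)) 1) with hV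
  have hV0 : V ≠ 0 := (Metric.measure_ball_pos volume _ one_pos).ne'
  have hVt : V ≠ ∞ := measure_ball_lt_top.ne
  -- The ball of radius `r / 2` about the midpoint lies in both balls of radius `r`; the volume
  -- ratio is the factor `2 ^ n`.
  set m := midpoint ℝ x y
  have hmx : dist m x = r / 2 := by
    rw [dist_midpoint_left, dist_eq_norm, ← hrdef]; norm_num; ring
  have hmy : dist m y = r / 2 := by
    rw [dist_midpoint_right, dist_eq_norm, ← hrdef]; norm_num; ring
  have hsx : Metric.ball m (r / 2) ⊆ Metric.ball x r :=
    Metric.ball_subset_ball' (by rw [hmx]; linarith)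
  have hsy : Metric.ball m (r / 2) ⊆ Metric.ball y r :=
    Metric.ball_subset_ball' (by rw [hmy]; linarith)
  have h1 : volume (Metric.ball m (r / 2)) * ‖f x - f y‖ₑ ≤
      (∫⁻ w in Metric.ball x r, ‖f w - f x‖ₑ) + ∫⁻ w in Metric.ball y r, ‖f w - f y‖ₑ := by
    calc volume (Metric.ball m (r / 2)) * ‖f x - f y‖ₑ
        = ∫⁻ w in Metric.ball m (r / 2), ‖f x - f y‖ₑ := by
          rw [setLIntegral_const, mul_comm]
      _ ≤ ∫⁻ w in Metric.ball m (r / 2), (‖f w - f x‖ₑ + ‖f w - f y‖ₑ) := by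
          refine lintegral_mono fun w => ?_
          have : f x - f y = -(f w - f x) + (f w - f y) := by ring
          rw [this]
          exact (enorm_add_le _ _).trans_eq (by rw [enorm_neg])
      _ = (∫⁻ w in Metric.ball m (r / 2), ‖f w - f x‖ₑ) +
          ∫⁻ w in Metric.ball m (r / 2), ‖f w - f y‖ₑ := by
          refine lintegral_add_left ?_ _
          exact (hf.continuous.sub continuous_const).enorm.measurable
      _ ≤ _ := add_le_add (lintegral_mono_set hsx) (lintegral_mono_set hsy)
  have h2 := h1.trans (add_le_add (setLIntegral_ball_enorm_sub_le hf x hr)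
    (setLIntegral_ball_enorm_sub_le hf y hr))
  rw [volume_ball_eq x hr, volume_ball_eq y hr, ← mul_add,
    volume_ball_eq _ (half_pos hr), ← hV] at h2
  have h3 : ENNReal.ofReal (r ^ n) * V = ENNReal.ofReal ((r / 2) ^ n) * V * 2 ^ n := by
    rw [mul_right_comm]
    congr 1
    rw [← ENNReal.ofReal_ofNat 2, ← ENNReal.ofReal_pow (by norm_num),
      ← ENNReal.ofReal_mul (by positivity), ← mul_pow]
    congr 2; ring
  have h4 : ENNReal.ofReal ((r / 2) ^ n) * V ≠ 0 :=
    mul_ne_zero (ENNReal.ofReal_pos.2 (by positivity)).ne' hV0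
  refine (ENNReal.mul_le_mul_iff_right h4 (ENNReal.mul_ne_top ENNReal.ofReal_ne_top hVt)).1 ?_
  refine h2.trans_eq ?_
  rw [h3]
  ring

end Gradient

/-! ### Large averages of the gradient and Vitali coverings. -/

section Covering

variable {n : ℕ} {f : EuclideanSpace ℝ (Fin n) → ℂ}

theorem setLIntegral_Ioo_rpow {δ a : ℝ} (hδ : 0 < δ) (ha : 0 ≤ a) :
    ∫⁻ t in Set.Ioo (0 : ℝ) 1, ENNReal.ofReal (a * t ^ (δ - 1)) = ENNReal.ofReal (a / δ) := by
  have hint : IntervalIntegrable (fun t : ℝ => t ^ (δ - 1)) volume 0 1 :=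
    intervalIntegral.intervalIntegrable_rpow' (by linarith)
  have hint2 : IntegrableOn (fun t : ℝ => a * t ^ (δ - 1)) (Set.Ioo 0 1) :=
    (((intervalIntegrable_iff_integrableOn_Ioc_of_le zero_le_one).1 hint).mono_set
      Set.Ioo_subset_Ioc_self).const_mul a
  rw [← ofReal_integral_eq_lintegral_ofReal hint2]
  · congr 1
    rw [← integral_Ioc_eq_integral_Ioo, ← intervalIntegral.integral_of_le zero_le_one,
      intervalIntegral.integral_const_mul, integral_rpow (Or.inl (by linarith))]
    simp [hδ.ne', div_eq_mul_inv]
  · filter_upwards [self_mem_ae_restrict measurableSet_Ioo] with t ht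
    have := ht.1
    positivity

/-- If the difference quotient of `f` at `(x, y)` is large, then the gradient has a large average
over some ball centred at `x` or `y`. -/
theorem exists_large_ballAvg (hf : ContDiff ℝ 1 f) {b l δ : ℝ} (hb : 0 ≤ b) (hl : 0 < l)
    (hδ : 0 < δ) (hδ1 : δ ≤ 1) {x y : EuclideanSpace ℝ (Fin n)}
    (h : (x, y) ∈ levelSet f l b) :
    ∃ j : ℕ, ∃ z, (z = x ∨ z = y) ∧ ∃ ρ : ℝ, 0 < ρ ∧ ‖x - y‖ < 2 ^ (j + 1) * ρ ∧
      ENNReal.ofReal (δ / 2 ^ (n + 1) * l * (2 ^ j) ^ (1 - δ + b) * ρ ^ b) ≤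
        ballAvg (fun z => ENNReal.ofReal (gradNorm f z)) z ρ := by
  obtain ⟨hxy, hlt⟩ := h
  simp only at hxy hlt
  set r := ‖x - y‖ with hrdef
  have hr : 0 < r := norm_pos_iff.2 (sub_ne_zero.2 hxy)
  -- If all averages were below the threshold, the two integrals over `t` would each be at most `c l
  -- r^b ∫ t^(δ-1) dt = c l r^b / δ`; this `c` makes the resulting bound on `‖f x - f y‖` exactly `l
  -- * r ^ (1 + b)`, a contradiction.
  set c := δ / 2 ^ (n + 1) with hc
  have hc0 : 0 < c := by positivity
  by_contra! hcon
  have key : ∀ z, (z = x ∨ z = y) → ∫⁻ t in Set.Ioo (0 : ℝ) 1,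
      ballAvg (fun z => ENNReal.ofReal (gradNorm f z)) z (t * r) ≤
        ENNReal.ofReal (c * l * r ^ b / δ) := by
    intro z hz
    rw [← setLIntegral_Ioo_rpow hδ (by positivity)]
    refine setLIntegral_mono' measurableSet_Ioo fun t ht => ?_
    have ht0 := ht.1
    -- The scale satisfies `2^j ≤ 1/t < 2^(j+1)`. The upper bound gives the required `r < 2^(j+1) *
    -- (t * r)`, the lower one compares the threshold with `t^(δ-1)`.
    obtain ⟨j, hj1, hj2⟩ := exists_nat_pow_near (x := 1 / t) (y := (2 : ℝ))
      ((one_le_div ht0).2 ht.2.le) (by norm_num)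
    have h1 := hcon j z hz (t * r) (by positivity) (by
      rw [div_lt_iff₀ ht0] at hj2
      calc r = 1 * r := (one_mul r).symm
        _ < 2 ^ (j + 1) * t * r := by gcongr
        _ = _ := by ring)
    refine h1.le.trans (ENNReal.ofReal_le_ofReal ?_)
    have h2 : ((2 : ℝ) ^ j) ^ (1 - δ + b) ≤ (1 / t) ^ (1 - δ + b) :=
      Real.rpow_le_rpow (by positivity) hj1 (by linarith)
    calc c * l * (2 ^ j) ^ (1 - δ + b) * (t * r) ^ b
        ≤ c * l * (1 / t) ^ (1 - δ + b) * (t * r) ^ b := by gcongr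
      _ = c * l * r ^ b * ((1 / t) ^ (1 - δ + b) * t ^ b) := by
        rw [Real.mul_rpow ht0.le hr.le]; ring
      _ = c * l * r ^ b * t ^ (δ - 1) := by
        congr 1
        rw [one_div, Real.inv_rpow ht0.le, ← Real.rpow_neg ht0.le, ← Real.rpow_add ht0]
        congr 1; ring
  have h1 := (enorm_sub_le_lintegral_ballAvg hf hxy).trans
    (mul_le_mul_right (add_le_add (key x (Or.inl rfl)) (key y (Or.inr rfl))) _)
  rw [← hrdef, ← ENNReal.ofReal_add (by positivity) (by positivity),
    ← ENNReal.ofReal_ofNat 2, ← ENNReal.ofReal_pow (by norm_num),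
    ← ENNReal.ofReal_mul (by positivity), ← ENNReal.ofReal_mul (by positivity),
    ← ofReal_norm, ENNReal.ofReal_le_ofReal_iff (by positivity)] at h1
  have h2 : (2 : ℝ) ^ n * r * (c * l * r ^ b / δ + c * l * r ^ b / δ) = l * r ^ (1 + b) := by
    rw [Real.rpow_add hr, Real.rpow_one, hc, pow_succ]
    field_simp
    ring
  rw [lt_div_iff₀ (by positivity)] at hlt
  linarith

/-- A Vitali covering of the balls on which the average of a bounded function is large. -/
theorem exists_disjoint_balls (hn : 1 ≤ n) {G : EuclideanSpace ℝ (Fin n) → ℝ≥0∞} {b τ M : ℝ}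
    (hb : 0 < b) (hτ : 0 < τ) (hM : ∀ x, G x ≤ ENNReal.ofReal M) :
    ∃ u : Set (EuclideanSpace ℝ (Fin n) × ℝ), u.Countable ∧
      (∀ a ∈ u, 0 < a.2 ∧ ENNReal.ofReal (τ * a.2 ^ b) ≤ ballAvg G a.1 a.2) ∧
      (u.PairwiseDisjoint fun a => Metric.ball a.1 a.2) ∧
      ∀ z ρ, 0 < ρ → ENNReal.ofReal (τ * ρ ^ b) ≤ ballAvg G z ρ →
        ∃ a ∈ u, z ∈ Metric.closedBall a.1 (5 * a.2) ∧ ρ ≤ 5 * a.2 := by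
  have : Nonempty (Fin n) := ⟨⟨0, hn⟩⟩
  set t : Set (EuclideanSpace ℝ (Fin n) × ℝ) :=
    {a | 0 < a.2 ∧ ENNReal.ofReal (τ * a.2 ^ b) ≤ ballAvg G a.1 a.2} with ht
  -- Vitali's lemma needs bounded radii: the average never exceeds the bound of `G`, whereas the
  -- threshold grows like `ρ ^ b`.
  have hbd : ∀ a ∈ t, a.2 ≤ (max M 0 / τ) ^ (1 / b) := by
    rintro a ⟨ha0, ha⟩
    have h1 : ballAvg G a.1 a.2 ≤ ENNReal.ofReal (max M 0) := by
      refine ENNReal.div_le_of_le_mul ?_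
      rw [← setLIntegral_const]
      exact lintegral_mono fun x => (hM x).trans (ENNReal.ofReal_le_ofReal (le_max_left _ _))
    have h2 := ha.trans h1
    rw [ENNReal.ofReal_le_ofReal_iff (le_max_right _ _)] at h2
    calc a.2 = (a.2 ^ b) ^ (1 / b) := by
          rw [← Real.rpow_mul ha0.le, mul_one_div_cancel hb.ne', Real.rpow_one]
      _ ≤ _ := Real.rpow_le_rpow (by positivity) ((le_div_iff₀' hτ).2 h2) (by positivity)
  obtain ⟨u, hut, hdisj, hcov⟩ := Vitali.exists_disjoint_subfamily_covering_enlargement_closedBall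
    t (fun a => a.1) (fun a => a.2) _ hbd 5 (by norm_num)
  have hdisj' : u.PairwiseDisjoint fun a => Metric.ball a.1 a.2 :=
    hdisj.mono fun a => Metric.ball_subset_closedBall
  refine ⟨u, ?_, fun a ha => hut ha, hdisj', fun z ρ hρ hz => ?_⟩
  · exact hdisj'.countable_of_isOpen (fun _ _ => Metric.isOpen_ball)
      fun a ha => Metric.nonempty_ball.2 (hut ha).1
  · obtain ⟨a, ha, hsub⟩ := hcov (z, ρ) ⟨hρ, hz⟩
    refine ⟨a, ha, hsub (Metric.mem_closedBall_self hρ.le), ?_⟩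
    have ha0 := (hut ha).1
    -- Comparing diameters turns the inclusion of balls into an inequality of radii; it requires a
    -- space of positive dimension.
    have h3 := Metric.diam_mono hsub Metric.isBounded_closedBall
    rw [Metric.diam_closedBall_eq _ hρ.le, Metric.diam_closedBall_eq _ (by positivity)] at h3
    linarith

end Covering

/-! ### The contribution of one ball to the weighted integral. -/

section Kernel

variable {n : ℕ}

theorem tsum_rpow_le_tsum_rpow {ι : Type*} (a : ι → ℝ≥0∞) {s : ℝ} (hs : 0 < s) (hs1 : s ≤ 1) :
    (∑' i, a i) ^ s ≤ ∑' i, a i ^ s := by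
  have h1 : Tendsto (fun t : Finset ι => (∑ i ∈ t, a i) ^ s) atTop (𝓝 ((∑' i, a i) ^ s)) :=
    ((ENNReal.continuous_rpow_const (y := s)).tendsto _).comp ENNReal.summable.hasSum
  refine le_of_tendsto' h1 fun t => ?_
  refine le_trans ?_ (ENNReal.sum_le_tsum t)
  classical
  induction t using Finset.induction_on with
  | empty => simp [hs]
  | insert i t hi ih =>
    rw [Finset.sum_insert hi, Finset.sum_insert hi]
    exact (ENNReal.rpow_add_le_add_rpow _ _ hs.le hs1).trans (add_le_add_right ih _)

/-- The kernel `|x - y|^(γ - n)`, truncated to `|x - y| < ϱ`. -/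
noncomputable def nearKernel (γ ϱ : ℝ) (x y : EuclideanSpace ℝ (Fin n)) : ℝ≥0∞ :=
  {z : EuclideanSpace ℝ (Fin n) × EuclideanSpace ℝ (Fin n) | ‖z.1 - z.2‖ < ϱ}.indicator
    (fun z => ENNReal.ofReal (‖z.1 - z.2‖ ^ (γ - n))) (x, y)

theorem measurable_nearKernel (γ ϱ : ℝ) :
    Measurable (fun z : EuclideanSpace ℝ (Fin n) × EuclideanSpace ℝ (Fin n) =>
      nearKernel γ ϱ z.1 z.2) := by
  refine Measurable.indicator ?_ ?_
  · exact ((measurable_fst.sub measurable_snd).norm.pow_const _).ennreal_ofReal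
  · exact measurableSet_lt (measurable_fst.sub measurable_snd).norm measurable_const

theorem measurable_nearKernel_left (γ ϱ : ℝ) (x : EuclideanSpace ℝ (Fin n)) :
    Measurable (nearKernel γ ϱ x) :=
  Measurable.of_uncurry_left (f := nearKernel γ ϱ) (measurable_nearKernel γ ϱ)

theorem nearKernel_comm (γ ϱ : ℝ) (x y : EuclideanSpace ℝ (Fin n)) :
    nearKernel γ ϱ x y = nearKernel γ ϱ y x := by
  simp only [nearKernel, Set.indicator_apply, Set.mem_ofPred_eq, norm_sub_rev x y]

theorem nearKernel_of_lt {γ ϱ : ℝ} {x y : EuclideanSpace ℝ (Fin n)} (h : ‖x - y‖ < ϱ) :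
    nearKernel γ ϱ x y = ENNReal.ofReal (‖x - y‖ ^ (γ - n)) := by
  simp [nearKernel, h]

theorem nearKernel_of_le {γ ϱ : ℝ} {x y : EuclideanSpace ℝ (Fin n)} (h : ϱ ≤ ‖x - y‖) :
    nearKernel γ ϱ x y = 0 := by
  simp [nearKernel, h]

theorem lintegral_nearKernel_mul (γ ϱ : ℝ) (ω : EuclideanSpace ℝ (Fin n) → ℝ≥0∞)
    (y : EuclideanSpace ℝ (Fin n)) :
    ∫⁻ x, nearKernel γ ϱ x y * ω x =
      ∫⁻ x in Metric.ball y ϱ, ENNReal.ofReal (‖x - y‖ ^ (γ - n)) * ω x := by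
  rw [← lintegral_indicator measurableSet_ball]
  refine lintegral_congr fun x => ?_
  by_cases hx : ‖x - y‖ < ϱ
  · rw [Set.indicator_of_mem (mem_ball_iff_norm.2 hx), nearKernel_of_lt hx]
  · rw [Set.indicator_of_notMem (mt mem_ball_iff_norm.1 hx), nearKernel_of_le (not_lt.1 hx),
      zero_mul]

/-- The integral of the truncated kernel over all `y` for `x` in a ball, plus the integral over `y`
in the same ball for all `x`. -/
noncomputable def localPart (γ : ℝ) (z : EuclideanSpace ℝ (Fin n)) (R ϱ : ℝ)
    (x : EuclideanSpace ℝ (Fin n)) : ℝ≥0∞ :=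
  ∫⁻ y, ((Metric.closedBall z R).indicator 1 x + (Metric.closedBall z R).indicator 1 y) *
    nearKernel γ ϱ x y

theorem measurable_localPart_integrand (γ : ℝ) (z : EuclideanSpace ℝ (Fin n)) (R ϱ : ℝ) :
    Measurable (fun w : EuclideanSpace ℝ (Fin n) × EuclideanSpace ℝ (Fin n) =>
      ((Metric.closedBall z R).indicator (1 : EuclideanSpace ℝ (Fin n) → ℝ≥0∞) w.1 +
        (Metric.closedBall z R).indicator 1 w.2) * nearKernel γ ϱ w.1 w.2) := by
  have h1 : Measurable ((Metric.closedBall z R).indicator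
      (1 : EuclideanSpace ℝ (Fin n) → ℝ≥0∞)) :=
    measurable_one.indicator measurableSet_closedBall
  exact ((h1.comp measurable_fst).add (h1.comp measurable_snd)).mul (measurable_nearKernel γ ϱ)

theorem measurable_localPart (γ : ℝ) (z : EuclideanSpace ℝ (Fin n)) (R ϱ : ℝ) :
    Measurable (localPart γ z R ϱ) :=
  (measurable_localPart_integrand γ z R ϱ).lintegral_prod_right'

theorem localPart_eq_zero (γ : ℝ) {z x : EuclideanSpace ℝ (Fin n)} {R ϱ : ℝ} (hϱ : 0 < ϱ)
    (hx : x ∉ Metric.ball z (R + ϱ)) : localPart γ z R ϱ x = 0 := by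
  refine (lintegral_congr fun y => ?_).trans lintegral_zero
  rw [mul_eq_zero]
  by_cases hxy : ‖x - y‖ < ϱ
  · left
    rw [mem_ball_iff_norm, not_lt] at hx
    rw [Set.indicator_of_notMem, Set.indicator_of_notMem, add_zero]
    · rw [mem_closedBall_iff_norm, not_le]
      have := norm_sub_le_norm_sub_add_norm_sub x y z
      linarith
    · rw [mem_closedBall_iff_norm, not_le]
      linarith
  · right
    exact nearKernel_of_le (not_lt.1 hxy)

/-- By Tonelli, the part with `x` in the ball integrates the kernel in `y` without weight, and the
part with `y` in the ball integrates it in `x` against `ω`, costing a factor `A` through `maxAvg ω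
y`. Together this gives `1 + A ≤ 2 * A`. -/
theorem lintegral_localPart_mul_le {γ : ℝ} {K A : ℝ≥0} {ω : EuclideanSpace ℝ (Fin n) → ℝ≥0∞}
    (hK : ∀ (ω : EuclideanSpace ℝ (Fin n) → ℝ≥0∞), Measurable ω →
      ∀ (y : EuclideanSpace ℝ (Fin n)) (R : ℝ), 0 < R →
      ∫⁻ x in Metric.ball y R, ENNReal.ofReal (‖x - y‖ ^ (γ - n)) * ω x ≤
        K * ENNReal.ofReal (R ^ γ) * maxAvg ω y)
    (hA : 1 ≤ A) (hω : Measurable ω) (hA1 : ∀ x, maxAvg ω x ≤ A * ω x)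
    (z : EuclideanSpace ℝ (Fin n)) (R : ℝ) {ϱ : ℝ} (hϱ : 0 < ϱ) :
    ∫⁻ x, localPart γ z R ϱ x * ω x ≤
      2 * A * K * ENNReal.ofReal (ϱ ^ γ) * ∫⁻ x in Metric.closedBall z R, ω x := by
  set B := Metric.closedBall z R with hB
  have hBm : MeasurableSet B := measurableSet_closedBall
  have h1B : Measurable (B.indicator (1 : EuclideanSpace ℝ (Fin n) → ℝ≥0∞)) :=
    measurable_one.indicator hBm
  have hmeas := measurable_nearKernel (n := n) γ ϱ
  have hx1 : ∀ x, ∫⁻ y, nearKernel γ ϱ x y ≤ K * ENNReal.ofReal (ϱ ^ γ) := fun x => by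
    have h1 := hK (fun _ => 1) measurable_const x ϱ hϱ
    rw [← lintegral_nearKernel_mul] at h1
    simp only [mul_one, ← nearKernel_comm γ ϱ x] at h1
    exact h1.trans (mul_le_of_le_one_right' (maxAvg_one_le x))
  have hy1 : ∀ y, ∫⁻ x, nearKernel γ ϱ x y * ω x ≤ K * ENNReal.ofReal (ϱ ^ γ) * (A * ω y) :=
    fun y => by
    rw [lintegral_nearKernel_mul]
    exact (hK ω hω y ϱ hϱ).trans (by gcongr; exact hA1 y)
  have hpos : ∀ x, localPart γ z R ϱ x * ω x =
      B.indicator 1 x * ω x * (∫⁻ y, nearKernel γ ϱ x y) +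
        ∫⁻ y, B.indicator 1 y * (nearKernel γ ϱ x y * ω x) := by
    intro x
    have hk : Measurable (nearKernel γ ϱ x) := measurable_nearKernel_left γ ϱ x
    have e1 : ∫⁻ y, B.indicator 1 y * (nearKernel γ ϱ x y * ω x) =
        (∫⁻ y, B.indicator 1 y * nearKernel γ ϱ x y) * ω x := by
      rw [← lintegral_mul_const (ω x) (f := fun y => B.indicator 1 y * nearKernel γ ϱ x y)
        (h1B.mul hk)]
      exact lintegral_congr fun y => (mul_assoc _ _ _).symm
    have e2 : localPart γ z R ϱ x = B.indicator 1 x * (∫⁻ y, nearKernel γ ϱ x y) +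
        ∫⁻ y, B.indicator 1 y * nearKernel γ ϱ x y := by
      rw [localPart, ← lintegral_const_mul _ hk, ← lintegral_add_left (hk.const_mul _)]
      exact lintegral_congr fun y => add_mul _ _ _
    rw [e1, e2]
    ring
  have hk1 : Measurable fun x => ∫⁻ y, nearKernel γ ϱ x y := hmeas.lintegral_prod_right'
  have hsplit : ∫⁻ x, localPart γ z R ϱ x * ω x =
      (∫⁻ x, B.indicator 1 x * ω x * (∫⁻ y, nearKernel γ ϱ x y)) +
        ∫⁻ x, ∫⁻ y, B.indicator 1 y * (nearKernel γ ϱ x y * ω x) := by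
    rw [lintegral_congr hpos]
    exact lintegral_add_left ((h1B.mul hω).mul hk1) _
  rw [hsplit]
  calc _ ≤ (∫⁻ x, B.indicator 1 x * ω x * (K * ENNReal.ofReal (ϱ ^ γ))) +
        ∫⁻ y, B.indicator 1 y * (K * ENNReal.ofReal (ϱ ^ γ) * (A * ω y)) := by
        refine add_le_add (lintegral_mono fun x => by gcongr; exact hx1 x) ?_
        rw [lintegral_lintegral_swap]
        · refine lintegral_mono fun y => ?_
          rw [lintegral_const_mul' _ _ (by by_cases hy : y ∈ B <;> simp [hy])]
          gcongr
          exact hy1 y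
        · exact ((h1B.comp measurable_snd).mul
            (hmeas.mul (hω.comp measurable_fst))).aemeasurable
    _ = (1 + A) * K * ENNReal.ofReal (ϱ ^ γ) * ∫⁻ x, B.indicator 1 x * ω x := by
        have e : ∀ y, B.indicator 1 y * (K * ENNReal.ofReal (ϱ ^ γ) * (A * ω y)) =
          (K * ENNReal.ofReal (ϱ ^ γ) * A) * (B.indicator 1 y * ω y) := fun y => by ring
        simp only [e]
        have hcK : (K : ℝ≥0∞) * ENNReal.ofReal (ϱ ^ γ) ≠ ∞ := by finiteness
        rw [lintegral_mul_const' _ _ hcK, lintegral_const_mul' _ _ (by finiteness)]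
        ring
    _ ≤ 2 * A * K * ENNReal.ofReal (ϱ ^ γ) * ∫⁻ x, B.indicator 1 x * ω x := by
        gcongr
        rw [two_mul]
        gcongr
        exact_mod_cast hA
    _ = _ := by
        rw [← lintegral_indicator hBm]
        congr 2 with x
        by_cases hx : x ∈ B <;> simp [hx]

/-- Hölder's inequality with exponents `1/s` and `1/(1-s)`, using that `localPart` vanishes outside
the larger ball. -/
theorem lintegral_localPart_rpow_mul_le {γ : ℝ} {K A : ℝ≥0}
    {ω : EuclideanSpace ℝ (Fin n) → ℝ≥0∞}
    (hK : ∀ (ω : EuclideanSpace ℝ (Fin n) → ℝ≥0∞), Measurable ω →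
      ∀ (y : EuclideanSpace ℝ (Fin n)) (R : ℝ), 0 < R →
      ∫⁻ x in Metric.ball y R, ENNReal.ofReal (‖x - y‖ ^ (γ - n)) * ω x ≤
        K * ENNReal.ofReal (R ^ γ) * maxAvg ω y)
    (hA : 1 ≤ A) (hω : Measurable ω) (hA1 : ∀ x, maxAvg ω x ≤ A * ω x)
    (z : EuclideanSpace ℝ (Fin n)) (R : ℝ) {ϱ s : ℝ} (hϱ : 0 < ϱ) (hs : 0 < s) (hs1 : s ≤ 1) :
    ∫⁻ x, localPart γ z R ϱ x ^ s * ω x ≤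
      (2 * A * K * ENNReal.ofReal (ϱ ^ γ) * ∫⁻ x in Metric.closedBall z R, ω x) ^ s *
        (∫⁻ x in Metric.ball z (R + ϱ), ω x) ^ (1 - s) := by
  have h1 : ∀ x, localPart γ z R ϱ x ^ s * ω x =
      (localPart γ z R ϱ x * ω x) ^ s *
        (Metric.ball z (R + ϱ)).indicator ω x ^ (1 - s) := by
    intro x
    by_cases hx : x ∈ Metric.ball z (R + ϱ)
    · rw [Set.indicator_of_mem hx, ENNReal.mul_rpow_of_nonneg _ _ hs.le, mul_assoc,
        ← ENNReal.rpow_add_of_nonneg _ _ hs.le (by linarith), add_sub_cancel, ENNReal.rpow_one]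
    · rw [localPart_eq_zero γ hϱ hx]
      simp [hs]
  simp only [h1]
  refine (ENNReal.lintegral_mul_norm_pow_le
    ((measurable_localPart γ z R ϱ).mul hω).aemeasurable
    (hω.indicator measurableSet_ball).aemeasurable hs.le (by linarith) (by ring)).trans ?_
  rw [lintegral_indicator measurableSet_ball]
  gcongr
  exact lintegral_localPart_mul_le hK hA hω hA1 z R hϱ

/-- The contribution of a single ball to the weighted estimate. -/
theorem exists_lintegral_localPart_le (n : ℕ) {γ s : ℝ} (hγ : 0 < γ) (hs : 0 < s) (hs1 : s ≤ 1) :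
    ∃ K : ℝ≥0, ∀ (A : ℝ≥0) (ω : EuclideanSpace ℝ (Fin n) → ℝ≥0∞), 1 ≤ A → Measurable ω →
      (∀ x, maxAvg ω x ≤ A * ω x) → ∀ (z : EuclideanSpace ℝ (Fin n)) (ρ : ℝ) (j : ℕ), 0 < ρ →
      ∀ x ∈ Metric.ball z ρ, ∫⁻ x, localPart γ z (5 * ρ) (2 ^ (j + 1) * (5 * ρ)) x ^ s * ω x ≤
        K * A ^ 2 * ENNReal.ofReal ((2 ^ j) ^ (n * (1 - s) + γ * s) * ρ ^ (γ * s)) *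
          volume (Metric.ball z ρ) * ω x := by
  obtain ⟨K, hK⟩ := setLIntegral_ball_kernel_le n hγ
  set K' : ℝ := (2 * K * 10 ^ γ * 10 ^ n) ^ s * (20 ^ n) ^ (1 - s) with hK'
  have hK'0 : 0 ≤ K' := by positivity
  refine ⟨K'.toNNReal, fun A ω hA hω hA1 z ρ j hρ x hx => ?_⟩
  have hs0 : 0 ≤ 1 - s := by linarith
  set ϱ : ℝ := 2 ^ (j + 1) * (5 * ρ) with hϱdef
  have h2j : (1 : ℝ) ≤ 2 ^ j := one_le_pow₀ (by norm_num)
  have hϱ : 0 < ϱ := by positivity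
  set v := volume (Metric.ball z ρ) with hv
  have hvol : ∀ c : ℝ, 0 < c → volume (Metric.ball z (c * ρ)) = ENNReal.ofReal (c ^ n) * v := by
    intro c hc
    rw [hv, volume_ball_eq z hρ, volume_ball_eq z (mul_pos hc hρ), mul_pow,
      ENNReal.ofReal_mul (by positivity), mul_assoc]
  -- Any concentric enlargement contains `x`, so its average of `ω` is at most `A * ω x`. It is used
  -- with `10`, to pass from the closed ball of radius `5ρ` to an open one, and with `20 * 2^j ≥ 5 +
  -- 10 * 2^j`.
  have hball : ∀ c : ℝ, 1 ≤ c → ∫⁻ x in Metric.ball z (c * ρ), ω x ≤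
      A * ω x * (ENNReal.ofReal (c ^ n) * v) := by
    intro c hc
    have hc0 : 0 < c := by linarith
    rw [← hvol c hc0]
    refine (setLIntegral_ball_le_maxAvg (mul_pos hc0 hρ)
      (Metric.ball_subset_ball (le_mul_of_one_le_left hρ.le hc) hx)).trans ?_
    gcongr
    exact hA1 x
  have hb1 : ∫⁻ x in Metric.closedBall z (5 * ρ), ω x ≤
      A * ω x * (ENNReal.ofReal (10 ^ n) * v) :=
    (lintegral_mono_set (Metric.closedBall_subset_ball (by linarith))).trans
      (hball 10 (by norm_num))
  have hb2 : ∫⁻ x in Metric.ball z (5 * ρ + ϱ), ω x ≤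
      A * ω x * (ENNReal.ofReal ((20 * 2 ^ j) ^ n) * v) := by
    refine (lintegral_mono_set (Metric.ball_subset_ball ?_)).trans
      (hball (20 * 2 ^ j) (by linarith))
    rw [hϱdef, pow_succ]
    nlinarith
  refine (lintegral_localPart_rpow_mul_le hK hA hω hA1 z (5 * ρ) hϱ hs hs1).trans ?_
  have hKK : (K : ℝ≥0∞) = ENNReal.ofReal K := ENNReal.ofReal_coe_nnreal.symm
  set W := A * ω x * v with hW
  calc _ ≤ (2 * A * K * ENNReal.ofReal (ϱ ^ γ) * (A * ω x * (ENNReal.ofReal (10 ^ n) * v))) ^ s *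
        (A * ω x * (ENNReal.ofReal ((20 * 2 ^ j) ^ n) * v)) ^ (1 - s) := by gcongr
    _ = (A * ENNReal.ofReal (2 * K * ϱ ^ γ * 10 ^ n) * W) ^ s *
        (ENNReal.ofReal ((20 * 2 ^ j) ^ n) * W) ^ (1 - s) := by
        congr 2
        · rw [ENNReal.ofReal_mul (by positivity), ENNReal.ofReal_mul (by positivity),
            ENNReal.ofReal_mul (by positivity), ← hKK, ENNReal.ofReal_ofNat]
          ring
        · ring
    _ = (A : ℝ≥0∞) ^ s * (ENNReal.ofReal ((2 * K * ϱ ^ γ * 10 ^ n) ^ s) *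
          ENNReal.ofReal (((20 * 2 ^ j) ^ n) ^ (1 - s))) * (W ^ s * W ^ (1 - s)) := by
        rw [ENNReal.mul_rpow_of_nonneg _ _ hs.le, ENNReal.mul_rpow_of_nonneg _ _ hs.le,
          ENNReal.mul_rpow_of_nonneg _ _ hs0, ENNReal.ofReal_rpow_of_nonneg (by positivity) hs.le,
          ENNReal.ofReal_rpow_of_nonneg (by positivity) hs0]
        ring
    _ = (A : ℝ≥0∞) ^ s *
          ENNReal.ofReal (K' * ((2 ^ j) ^ (n * (1 - s) + γ * s) * ρ ^ (γ * s))) * W := by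
        rw [← ENNReal.rpow_add_of_nonneg _ _ hs.le hs0, add_sub_cancel, ENNReal.rpow_one,
          ← ENNReal.ofReal_mul (by positivity)]
        congr 3
        have e1 : ϱ = 10 * 2 ^ j * ρ := by rw [hϱdef, pow_succ]; ring
        have e2 : 2 * (K : ℝ) * ϱ ^ γ * 10 ^ n =
            (2 * K * 10 ^ γ * 10 ^ n) * ((2 ^ j) ^ γ * ρ ^ γ) := by
          rw [e1, Real.mul_rpow (by positivity) hρ.le,
            Real.mul_rpow (by positivity) (by positivity)]
          ring
        rw [e2, hK', mul_pow, Real.mul_rpow (x := 20 ^ n) (by positivity) (by positivity),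
          Real.mul_rpow (by positivity) (by positivity),
          Real.mul_rpow (x := (2 ^ j) ^ γ) (by positivity) (by positivity),
          ← Real.rpow_mul (by positivity), ← Real.rpow_mul hρ.le,
          Real.rpow_add (by positivity), Real.rpow_mul (x := 2 ^ j) (y := n) (by positivity),
          Real.rpow_natCast]
        ring
    -- One factor `A` is already inside `W`; bounding `A ^ s` by `A` yields the final `A ^ 2`.
    _ ≤ A * ENNReal.ofReal (K' * ((2 ^ j) ^ (n * (1 - s) + γ * s) * ρ ^ (γ * s))) * W := by
        gcongr
        calc (A : ℝ≥0∞) ^ s ≤ (A : ℝ≥0∞) ^ (1 : ℝ) :=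
              ENNReal.rpow_le_rpow_of_exponent_le (by exact_mod_cast hA) hs1
          _ = A := ENNReal.rpow_one _
    _ = _ := by
        rw [ENNReal.ofReal_mul hK'0, hW]
        change _ = ENNReal.ofReal K' * _ * _ * _ * _
        ring

end Kernel

/-! ### The weighted estimate for `p ≤ q`. -/

section Weighted

variable {n : ℕ}

/-- Jensen's inequality for the average, derived from Hölder's inequality against the constant `1`.
-/
theorem ballAvg_rpow_mul_volume_le {G : EuclideanSpace ℝ (Fin n) → ℝ≥0∞} (hG : Measurable G)
    (z : EuclideanSpace ℝ (Fin n)) {ρ p : ℝ} (hρ : 0 < ρ) (hp : 1 ≤ p) :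
    ballAvg G z ρ ^ p * volume (Metric.ball z ρ) ≤ ∫⁻ x in Metric.ball z ρ, G x ^ p := by
  have hp0 : 0 < p := by linarith
  set v := volume (Metric.ball z ρ) with hv
  have hv0 : v ≠ 0 := (Metric.measure_ball_pos volume z hρ).ne'
  have hvt : v ≠ ∞ := measure_ball_lt_top.ne
  have hp1 : 1 / p ≤ 1 := (div_le_one hp0).2 hp
  have h1 := ENNReal.lintegral_mul_norm_pow_le (μ := volume.restrict (Metric.ball z ρ))
    (f := fun x => G x ^ p) (g := fun _ => 1) (hG.pow_const p).aemeasurable aemeasurable_const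
    (p := 1 / p) (q := 1 - 1 / p) (by positivity) (by linarith) (by ring)
  have e1 : ∀ x, (G x ^ p) ^ (1 / p) = G x := fun x => by
    rw [← ENNReal.rpow_mul, mul_one_div_cancel hp0.ne', ENNReal.rpow_one]
  simp only [e1, ENNReal.one_rpow, mul_one, setLIntegral_one, ← hv] at h1
  calc ballAvg G z ρ ^ p * v
      ≤ (((∫⁻ x in Metric.ball z ρ, G x ^ p) ^ (1 / p) * v ^ (1 - 1 / p)) / v) ^ p * v := by
        rw [ballAvg, ← hv]
        gcongr
    _ = ((∫⁻ x in Metric.ball z ρ, G x ^ p) ^ (1 / p) * v ^ (-(1 / p))) ^ p * v := by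
        rw [mul_div_assoc, div_eq_mul_inv (v ^ _) v, ← ENNReal.rpow_neg_one v,
          ← ENNReal.rpow_add _ _ hv0 hvt]
        congr 4
        ring
    _ = (∫⁻ x in Metric.ball z ρ, G x ^ p) := by
        rw [ENNReal.mul_rpow_of_nonneg _ _ hp0.le, ← ENNReal.rpow_mul, ← ENNReal.rpow_mul,
          one_div_mul_cancel hp0.ne', neg_mul, one_div_mul_cancel hp0.ne', ENNReal.rpow_one,
          ENNReal.rpow_neg_one, mul_assoc, ENNReal.inv_mul_cancel hv0 hvt, mul_one]

/-- The bound on `S` holds at every point of the ball, so it may be multiplied by `G x ^ p` and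
integrated. By Jensen and the large average, `ρ^(b*p)` times the volume is at most `τ^(-p) ∫ G^p`;
the integral of `G^p` then cancels, being positive and finite. -/
theorem le_setLIntegral_of_forall_le_weight {G ω : EuclideanSpace ℝ (Fin n) → ℝ≥0∞}
    (hG : Measurable G) (hω : Measurable ω) {M b p τ ρ : ℝ} (hM : ∀ x, G x ≤ ENNReal.ofReal M)
    {z : EuclideanSpace ℝ (Fin n)} (hρ : 0 < ρ) (hp : 1 ≤ p) (hτ : 0 < τ)
    (hz : ENNReal.ofReal (τ * ρ ^ b) ≤ ballAvg G z ρ) {S c : ℝ≥0∞}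
    (hS : ∀ x ∈ Metric.ball z ρ,
      S ≤ c * ENNReal.ofReal (ρ ^ (b * p)) * volume (Metric.ball z ρ) * ω x) :
    S ≤ c * ENNReal.ofReal (τ ^ (-p)) * ∫⁻ x in Metric.ball z ρ, G x ^ p * ω x := by
  have hp0 : 0 < p := by linarith
  set v := volume (Metric.ball z ρ) with hv
  have hv0 : v ≠ 0 := (Metric.measure_ball_pos volume z hρ).ne'
  have hvt : v ≠ ∞ := measure_ball_lt_top.ne
  have hJ := ballAvg_rpow_mul_volume_le hG z hρ hp
  rw [← hv] at hJ
  set I := ∫⁻ x in Metric.ball z ρ, G x ^ p with hI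
  have hI0 : I ≠ 0 := by
    refine ne_of_gt (lt_of_lt_of_le ?_ hJ)
    refine ENNReal.mul_pos (ENNReal.rpow_pos_of_nonneg ?_ hp0.le).ne' hv0
    exact lt_of_lt_of_le (ENNReal.ofReal_pos.2 (by positivity)) hz
  have hIt : I ≠ ∞ := by
    refine ne_top_of_le_ne_top (b := ENNReal.ofReal M ^ p * v) ?_ ?_
    · exact ENNReal.mul_ne_top (ENNReal.rpow_ne_top_of_nonneg hp0.le ENNReal.ofReal_ne_top) hvt
    · rw [hv, ← setLIntegral_const]
      exact lintegral_mono fun x => ENNReal.rpow_le_rpow (hM x) hp0.le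
  have h1 : ENNReal.ofReal (ρ ^ (b * p)) * v ≤ ENNReal.ofReal (τ ^ (-p)) * I := by
    have e : ρ ^ (b * p) = τ ^ (-p) * (τ * ρ ^ b) ^ p := by
      rw [Real.mul_rpow hτ.le (by positivity), ← Real.rpow_mul hρ.le, ← mul_assoc,
        ← Real.rpow_add hτ]
      simp
    rw [e, ENNReal.ofReal_mul (by positivity),
      ← ENNReal.ofReal_rpow_of_nonneg (by positivity) hp0.le, mul_assoc]
    gcongr
    exact le_trans (by gcongr) hJ
  have h2 : I * S ≤ I * (c * ENNReal.ofReal (τ ^ (-p)) *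
      ∫⁻ x in Metric.ball z ρ, G x ^ p * ω x) := by
    calc I * S = ∫⁻ x in Metric.ball z ρ, G x ^ p * S :=
          (lintegral_mul_const _ (hG.pow_const p)).symm
      _ ≤ ∫⁻ x in Metric.ball z ρ,
          (c * (ENNReal.ofReal (τ ^ (-p)) * I)) * (G x ^ p * ω x) := by
          refine setLIntegral_mono' measurableSet_ball fun x hx => ?_
          calc G x ^ p * S ≤ G x ^ p * (c * (ENNReal.ofReal (τ ^ (-p)) * I) * ω x) := by
                gcongr
                refine (hS x hx).trans ?_
                rw [mul_assoc c]
                gcongr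
            _ = _ := by ring
      _ = _ := by
          have hm : Measurable fun x => G x ^ p * ω x := (hG.pow_const p).mul hω
          rw [lintegral_const_mul _ hm]
          ring
  exact (ENNReal.mul_le_mul_iff_right hI0 hIt).1 h2

theorem tsum_setLIntegral_ball_le {u : Set (EuclideanSpace ℝ (Fin n) × ℝ)} (hu : u.Countable)
    (hd : u.PairwiseDisjoint fun a => Metric.ball a.1 a.2)
    (h : EuclideanSpace ℝ (Fin n) → ℝ≥0∞) :
    ∑' a : u, ∫⁻ x in Metric.ball a.1.1 a.1.2, h x ≤ ∫⁻ x, h x := by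
  rw [← lintegral_biUnion hu (fun a _ => measurableSet_ball) hd]
  exact setLIntegral_le_lintegral _ _

theorem measurableSet_levelSet {f : EuclideanSpace ℝ (Fin n) → ℂ} (hf : Measurable f)
    (l b : ℝ) : MeasurableSet (levelSet f l b) := by
  have h1 : Measurable fun z : EuclideanSpace ℝ (Fin n) × EuclideanSpace ℝ (Fin n) =>
      ‖f z.1 - f z.2‖ / ‖z.1 - z.2‖ ^ (1 + b) :=
    (((hf.comp measurable_fst).sub (hf.comp measurable_snd)).norm).div
      ((measurable_fst.sub measurable_snd).norm.pow_const _)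
  exact (measurableSet_eq_fun measurable_fst measurable_snd).compl.inter
    (measurableSet_lt measurable_const h1)

theorem measurable_bvyFn {f : EuclideanSpace ℝ (Fin n) → ℂ} (hf : Measurable f)
    (γ q l : ℝ) : Measurable (bvyFn f γ q l) := by
  have h1 : Measurable fun z : EuclideanSpace ℝ (Fin n) × EuclideanSpace ℝ (Fin n) =>
      (levelSet f l (γ / q)).indicator (fun z => ENNReal.ofReal (‖z.1 - z.2‖ ^ (γ - n))) z :=
    (((measurable_fst.sub measurable_snd).norm.pow_const _).ennreal_ofReal).indicator
      (measurableSet_levelSet hf l _)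
  exact (h1.lintegral_prod_right').pow_const _

/-- The weighted estimate, with an explicit dependence on the constant of the weight. -/
theorem exists_lintegral_bvyFn_rpow_mul_le (hn : 1 ≤ n) {γ p q : ℝ} (hγ : 0 < γ) (hp : 1 ≤ p)
    (hpq : p ≤ q) (hnpq : (n : ℝ) * (1 / p - 1 / q) < 1) :
    ∃ K : ℝ≥0, ∀ f : EuclideanSpace ℝ (Fin n) → ℂ, ContDiff ℝ 1 f →
      HasCompactSupport (gradNorm f) → ∀ l : ℝ, 0 < l →
      ∀ (A : ℝ≥0) (ω : EuclideanSpace ℝ (Fin n) → ℝ≥0∞), 1 ≤ A → Measurable ω →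
      (∀ x, maxAvg ω x ≤ A * ω x) →
      ∫⁻ x, bvyFn f γ q l x ^ p * ω x ≤ K * A ^ 2 * ENNReal.ofReal (l ^ (-p)) *
        ∫⁻ x, ENNReal.ofReal (gradNorm f x) ^ p * ω x := by
  have hp0 : 0 < p := by linarith
  have hq0 : 0 < q := by linarith
  set s := p / q with hsdef
  have hs : 0 < s := by positivity
  have hs1 : s ≤ 1 := (div_le_one hq0).2 hpq
  set b := γ / q with hbdef
  have hb : 0 < b := by positivity
  have hγs : γ * s = b * p := by rw [hsdef, hbdef]; ring
  set d := (n : ℝ) * (1 / p - 1 / q) with hd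
  have hd0 : 0 ≤ d := by
    have : 1 / q ≤ 1 / p := one_div_le_one_div_of_le hp0 hpq
    exact mul_nonneg (Nat.cast_nonneg n) (by linarith)
  -- Since `σ = p * (d - (1 - δ))`, any positive `δ < 1 - d` makes the ratio `2^σ` less than `1`;
  -- the midpoint is taken.
  set δ := (1 - d) / 2 with hδdef
  have hδ : 0 < δ := by linarith
  have hδ1 : δ ≤ 1 := by linarith
  set σ := n * (1 - s) - p * (1 - δ) with hσ
  have hσ0 : σ < 0 := by
    have e : (n : ℝ) * (1 - s) = p * d := by
      rw [hd, hsdef]; field_simp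
    rw [hσ, e, ← mul_sub]
    exact mul_neg_of_pos_of_neg hp0 (by linarith)
  obtain ⟨K, hK⟩ := exists_lintegral_localPart_le n hγ hs hs1
  set c : ℝ := δ / 2 ^ (n + 1) with hc
  have hc0 : 0 < c := by positivity
  have hgeo : (1 - ENNReal.ofReal (2 ^ σ))⁻¹ ≠ ∞ := by
    rw [ENNReal.inv_ne_top]
    have : ENNReal.ofReal (2 ^ σ) < 1 := by
      rw [ENNReal.ofReal_lt_one]
      exact Real.rpow_lt_one_of_one_lt_of_neg (by norm_num) hσ0
    exact (tsub_pos_of_lt this).ne'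
  set k : ℝ≥0∞ := K * ENNReal.ofReal (c ^ (-p)) * (1 - ENNReal.ofReal (2 ^ σ))⁻¹ with hk
  have hkt : k ≠ ∞ := by finiteness
  refine ⟨k.toNNReal, fun f hf hfc l hl A ω hA hω hA1 => ?_⟩
  rw [ENNReal.coe_toNNReal hkt]
  have hGc := continuous_gradNorm hf
  obtain ⟨M, hM⟩ := hfc.exists_bound_of_continuous hGc
  set G : EuclideanSpace ℝ (Fin n) → ℝ≥0∞ := fun x => ENNReal.ofReal (gradNorm f x) with hGdef
  have hG : Measurable G := hGc.measurable.ennreal_ofReal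
  have hGM : ∀ x, G x ≤ ENNReal.ofReal M := fun x =>
    ENNReal.ofReal_le_ofReal ((le_abs_self _).trans (hM x))
  set τ : ℕ → ℝ := fun j => c * l * (2 ^ j) ^ (1 - δ + b) with hτ
  have hτ0 : ∀ j, 0 < τ j := fun j => by positivity
  -- Each scale `j` has its own threshold and its own Vitali family; disjointness is only available
  -- within one family.
  choose u huc hu hud hcov using fun j =>
    exists_disjoint_balls hn (G := G) hb (hτ0 j) hGM
  set T : ∀ j, u j → EuclideanSpace ℝ (Fin n) → ℝ≥0∞ := fun j a =>
    localPart γ a.1.1 (5 * a.1.2) (2 ^ (j + 1) * (5 * a.1.2)) with hT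
  have hcount : ∀ j, Countable (u j) := fun j => (huc j).to_subtype
  have hTm : ∀ j a, Measurable fun x => T j a x ^ s * ω x := fun j a =>
    ((measurable_localPart _ _ _ _).pow_const s).mul hω
  -- Each pair of the level set is caught by some `j` and some selected ball, so the kernel is
  -- dominated by the sum of local parts; since `s ≤ 1`, the power passes inside the sums.
  have hpt : ∀ x, bvyFn f γ q l x ^ p ≤ ∑' j, ∑' a, T j a x ^ s := by
    intro x
    have h1 : bvyFn f γ q l x ^ p = (∫⁻ y, (levelSet f l b).indicator
        (fun z => ENNReal.ofReal (‖z.1 - z.2‖ ^ (γ - n))) (x, y)) ^ s := by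
      rw [bvyFn, ← ENNReal.rpow_mul, hsdef]
      congr 1
      ring
    have h2 : ∫⁻ y, (levelSet f l b).indicator
        (fun z => ENNReal.ofReal (‖z.1 - z.2‖ ^ (γ - n))) (x, y) ≤ ∑' j, ∑' a, T j a x := by
      have hmi : ∀ j (a : u j), Measurable fun y =>
          ((Metric.closedBall a.1.1 (5 * a.1.2)).indicator
              (1 : EuclideanSpace ℝ (Fin n) → ℝ≥0∞) x +
            (Metric.closedBall a.1.1 (5 * a.1.2)).indicator 1 y) *
            nearKernel γ (2 ^ (j + 1) * (5 * a.1.2)) x y := fun j a =>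
        ((measurable_one.indicator measurableSet_closedBall).const_add _).mul
          (measurable_nearKernel_left _ _ x)
      simp only [hT, localPart]
      simp_rw [← lintegral_tsum fun a => (hmi _ a).aemeasurable]
      rw [← lintegral_tsum fun j => (Measurable.tsum fun a => hmi j a).aemeasurable]
      refine lintegral_mono fun y => ?_
      by_cases hxy : (x, y) ∈ levelSet f l b
      · obtain ⟨j, z, hz, ρ, hρ, hr, havg⟩ := exists_large_ballAvg hf hb.le hl hδ hδ1 hxy
        obtain ⟨a, ha, hza, hρa⟩ := hcov j z ρ hρ havg
        have ha0 := (hu j a ha).1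
        refine le_trans ?_ (ENNReal.le_tsum j)
        refine le_trans ?_ (ENNReal.le_tsum (⟨a, ha⟩ : u j))
        rw [Set.indicator_of_mem hxy, nearKernel_of_lt
          (hr.trans_le (mul_le_mul_of_nonneg_left hρa (by positivity)))]
        refine le_mul_of_one_le_left zero_le ?_
        rcases hz with rfl | rfl
        · rw [Set.indicator_of_mem hza]; exact le_self_add
        · rw [Set.indicator_of_mem hza]; exact le_add_self
      · rw [Set.indicator_of_notMem hxy]
        exact zero_le
    rw [h1]
    refine (ENNReal.rpow_le_rpow h2 hs.le).trans ?_
    refine (tsum_rpow_le_tsum_rpow _ hs hs1).trans ?_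
    exact ENNReal.tsum_le_tsum fun j => tsum_rpow_le_tsum_rpow _ hs hs1
  set J := ∫⁻ x, G x ^ p * ω x with hJ
  have hball : ∀ j (a : u j), ∫⁻ x, T j a x ^ s * ω x ≤
      K * A ^ 2 * ENNReal.ofReal ((2 ^ j) ^ (n * (1 - s) + γ * s)) *
        ENNReal.ofReal (τ j ^ (-p)) *
          ∫⁻ x in Metric.ball a.1.1 a.1.2, G x ^ p * ω x := by
    intro j a
    obtain ⟨ha0, ha⟩ := hu j a a.2
    refine le_setLIntegral_of_forall_le_weight hG hω hGM ha0 hp (hτ0 j) ha fun x hx => ?_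
    refine (hK A ω hA hω hA1 a.1.1 a.1.2 j ha0 x hx).trans_eq ?_
    rw [ENNReal.ofReal_mul (by positivity), hγs]
    ring
  calc ∫⁻ x, bvyFn f γ q l x ^ p * ω x
      ≤ ∫⁻ x, ∑' j, ∑' a, T j a x ^ s * ω x := by
        refine lintegral_mono fun x => ?_
        simp only [ENNReal.tsum_mul_right]
        gcongr
        exact hpt x
    _ = ∑' j, ∑' a, ∫⁻ x, T j a x ^ s * ω x := by
        rw [lintegral_tsum fun j => (Measurable.tsum fun a => hTm j a).aemeasurable]
        congr! 2 with j
        exact lintegral_tsum fun a => (hTm j a).aemeasurable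
    _ ≤ ∑' j, ∑' a : u j, K * A ^ 2 * ENNReal.ofReal ((2 ^ j) ^ (n * (1 - s) + γ * s)) *
        ENNReal.ofReal (τ j ^ (-p)) * ∫⁻ x in Metric.ball a.1.1 a.1.2, G x ^ p * ω x :=
        ENNReal.tsum_le_tsum fun j => ENNReal.tsum_le_tsum fun a => hball j a
    _ ≤ ∑' j, K * A ^ 2 * ENNReal.ofReal ((2 ^ j) ^ (n * (1 - s) + γ * s)) *
        ENNReal.ofReal (τ j ^ (-p)) * J := by
        refine ENNReal.tsum_le_tsum fun j => ?_
        rw [ENNReal.tsum_mul_left]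
        gcongr
        exact tsum_setLIntegral_ball_le (huc j) (hud j) _
    -- The powers of `2^j` add up to `n(1-s) + γs - p(1-δ+b)`, which is `σ` because `γs = bp`.
    _ = ∑' j, K * A ^ 2 * ENNReal.ofReal (c ^ (-p)) * ENNReal.ofReal (l ^ (-p)) * J *
        ENNReal.ofReal (2 ^ σ) ^ j := by
        congr! 2 with j
        have e1 : ENNReal.ofReal ((2 ^ j) ^ (n * (1 - s) + γ * s)) * ENNReal.ofReal (τ j ^ (-p)) =
            ENNReal.ofReal (c ^ (-p)) * ENNReal.ofReal (l ^ (-p)) *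
              ENNReal.ofReal (2 ^ σ) ^ j := by
          rw [← ENNReal.ofReal_mul (by positivity), ← ENNReal.ofReal_mul (by positivity),
            ← ENNReal.ofReal_pow (by positivity), ← ENNReal.ofReal_mul (by positivity)]
          congr 1
          have e2 : ((2 : ℝ) ^ σ) ^ j = (2 ^ j) ^ (n * (1 - s) + γ * s) *
              ((2 ^ j) ^ (1 - δ + b)) ^ (-p) := by
            rw [← Real.rpow_mul (by positivity), ← Real.rpow_add (by positivity),
              ← Real.rpow_natCast, ← Real.rpow_natCast, ← Real.rpow_mul (by norm_num),
              ← Real.rpow_mul (by norm_num), hγs, hσ]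
            congr 1
            ring
          rw [e2, hτ, Real.mul_rpow (by positivity) (by positivity),
            Real.mul_rpow hc0.le hl.le]
          ring
        calc _ = K * A ^ 2 * (ENNReal.ofReal ((2 ^ j) ^ (n * (1 - s) + γ * s)) *
              ENNReal.ofReal (τ j ^ (-p))) * J := by ring
          _ = _ := by rw [e1]; ring
    _ = k * A ^ 2 * ENNReal.ofReal (l ^ (-p)) * J := by
        rw [ENNReal.tsum_mul_left, ENNReal.tsum_geometric, hk]
        ring

end Weighted

/-! ### Reduction of the case `q < p` to `q = p`. -/

section Reduction

variable {n : ℕ}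

/-- Raising the exponent `q`, with `γ / q` fixed, increases the functional up to a constant. -/
theorem exists_bvyFn_le_mul_bvyFn (n : ℕ) {γ p q : ℝ} (hγ : 0 < γ) (hq : 0 < q) (hqp : q < p) :
    ∃ C : ℝ≥0, ∀ (f : EuclideanSpace ℝ (Fin n) → ℂ), Measurable f →
      ∀ (l : ℝ) (x : EuclideanSpace ℝ (Fin n)),
      bvyFn f γ q l x ≤ C * bvyFn f (γ / q * p) p l x := by
  have hp : 0 < p := hq.trans hqp
  obtain ⟨K, hK⟩ := setLIntegral_ball_kernel_le n hγ
  -- This choice keeps `γ' / p = γ / q`, so both functionals have the same level set.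
  set γ' := γ / q * p with hγ'def
  have hγ' : 0 < γ' := by positivity
  have hγγ' : γ ≤ γ' := by
    rw [hγ'def, div_mul_eq_mul_div, le_div_iff₀ hq]
    gcongr
  have hb : γ' / p = γ / q := by rw [hγ'def]; field_simp
  refine ⟨(K + 1) ^ (1 / q), fun f hf l x => ?_⟩
  rw [bvyFn, bvyFn, hb]
  set E := levelSet f l (γ / q) with hE
  have hEm : MeasurableSet E := measurableSet_levelSet hf _ _
  have hint : ∀ g : ℝ, Measurable fun y => E.indicator
      (fun z => ENNReal.ofReal (‖z.1 - z.2‖ ^ (g - n))) (x, y) := fun g =>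
    ((((measurable_fst.sub measurable_snd).norm.pow_const _).ennreal_ofReal).indicator
      hEm).comp measurable_prodMk_left
  set W := ∫⁻ y, E.indicator (fun z => ENNReal.ofReal (‖z.1 - z.2‖ ^ (γ - n))) (x, y) with hW
  set W' := ∫⁻ y, E.indicator (fun z => ENNReal.ofReal (‖z.1 - z.2‖ ^ (γ' - n))) (x, y)
    with hW'
  have hpos : ∀ y, (x, y) ∈ E → 0 < ‖x - y‖ := fun y hy => norm_pos_iff.2 (sub_ne_zero.2 hy.1)
  have hsplit : ∀ R : ℝ, 0 < R →
      W ≤ K * ENNReal.ofReal (R ^ γ) + ENNReal.ofReal (R ^ (γ - γ')) * W' := by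
    intro R hR
    have hker : ∫⁻ y, nearKernel γ R x y ≤ K * ENNReal.ofReal (R ^ γ) := by
      have h1 := hK (fun _ => 1) measurable_const x R hR
      rw [← lintegral_nearKernel_mul] at h1
      simp only [mul_one, ← nearKernel_comm γ R x] at h1
      exact h1.trans (mul_le_of_le_one_right' (maxAvg_one_le x))
    calc W ≤ ∫⁻ y, (nearKernel γ R x y + ENNReal.ofReal (R ^ (γ - γ')) *
          E.indicator (fun z => ENNReal.ofReal (‖z.1 - z.2‖ ^ (γ' - n))) (x, y)) := by
          refine lintegral_mono fun y => ?_
          by_cases hy : (x, y) ∈ E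
          · simp only [Set.indicator_of_mem hy]
            rcases lt_or_ge ‖x - y‖ R with h | h
            · rw [nearKernel_of_lt h]
              exact le_self_add
            · refine le_add_of_nonneg_of_le zero_le ?_
              rw [← ENNReal.ofReal_mul (by positivity)]
              refine ENNReal.ofReal_le_ofReal ?_
              calc ‖x - y‖ ^ (γ - n) = ‖x - y‖ ^ (γ - γ') * ‖x - y‖ ^ (γ' - n) := by
                    rw [← Real.rpow_add (hpos y hy)]
                    congr 1; ring
                _ ≤ R ^ (γ - γ') * ‖x - y‖ ^ (γ' - n) :=
                    mul_le_mul_of_nonneg_right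
                      (Real.rpow_le_rpow_of_nonpos hR h (by linarith)) (by positivity)
          · simp only [Set.indicator_of_notMem hy]
            exact zero_le
      _ = (∫⁻ y, nearKernel γ R x y) + ENNReal.ofReal (R ^ (γ - γ')) * W' := by
          rw [lintegral_add_left (measurable_nearKernel_left γ R x),
            lintegral_const_mul _ (hint γ')]
      _ ≤ _ := by gcongr
  have hmain : W ≤ (K + 1 : ℝ≥0) * W' ^ (γ / γ') := by
    rcases eq_or_ne W' 0 with h0 | h0
    · have h1 := (lintegral_eq_zero_iff (hint γ')).1 (hW' ▸ h0)
      have h2 : W = 0 := by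
        rw [hW, lintegral_eq_zero_iff (hint γ)]
        filter_upwards [h1] with y hy
        by_cases hyE : (x, y) ∈ E
        · rw [Set.indicator_of_mem hyE, Pi.zero_apply, ENNReal.ofReal_eq_zero] at hy
          exact absurd hy (not_le.2 (Real.rpow_pos_of_pos (hpos y hyE) _))
        · rw [Set.indicator_of_notMem hyE, Pi.zero_apply]
      rw [h2]
      exact zero_le
    rcases eq_or_ne W' ∞ with ht | ht
    · rw [ht, ENNReal.top_rpow_of_pos (by positivity), ENNReal.mul_top]
      · exact le_top
      · simp
    · have hw : 0 < W'.toReal := ENNReal.toReal_pos h0 ht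
      -- This radius balances the two terms of the splitting: both `R ^ γ` and `R ^ (γ - γ') * W'`
      -- equal `W' ^ (γ / γ')`.
      have h1 := hsplit (W'.toReal ^ (1 / γ')) (by positivity)
      rw [← Real.rpow_mul hw.le, ← Real.rpow_mul hw.le,
        ← ENNReal.ofReal_rpow_of_pos hw, ← ENNReal.ofReal_rpow_of_pos hw,
        ENNReal.ofReal_toReal ht] at h1
      refine h1.trans_eq ?_
      have e1 : W' ^ (1 / γ' * (γ - γ')) * W' = W' ^ (γ / γ') := by
        conv_lhs => rw [← ENNReal.rpow_one W', ← ENNReal.rpow_mul, one_mul,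
          ← ENNReal.rpow_add _ _ h0 ht]
        congr 1
        field_simp
        ring
      rw [e1, one_div_mul_eq_div, ENNReal.coe_add, ENNReal.coe_one]
      ring
  calc W ^ (1 / q) ≤ ((K + 1 : ℝ≥0) * W' ^ (γ / γ')) ^ (1 / q) := by gcongr
    _ = _ := by
      rw [ENNReal.mul_rpow_of_nonneg _ _ (by positivity), ← ENNReal.rpow_mul,
        ENNReal.coe_rpow_of_nonneg _ (by positivity)]
      congr 2
      rw [hγ'def]
      field_simp

/-- The weighted estimate for all admissible exponents. -/
theorem exists_lintegral_bvyFn_rpow_mul_le' (hn : 1 ≤ n) {γ p q : ℝ} (hγ : 0 < γ) (hp : 1 ≤ p)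
    (hq : 0 < q) (hnpq : (n : ℝ) * (1 / p - 1 / q) < 1) :
    ∃ K : ℝ≥0, ∀ f : EuclideanSpace ℝ (Fin n) → ℂ, ContDiff ℝ 1 f →
      HasCompactSupport (gradNorm f) → ∀ l : ℝ, 0 < l →
      ∀ (A : ℝ≥0) (ω : EuclideanSpace ℝ (Fin n) → ℝ≥0∞), 1 ≤ A → Measurable ω →
      (∀ x, maxAvg ω x ≤ A * ω x) →
      ∫⁻ x, bvyFn f γ q l x ^ p * ω x ≤ K * A ^ 2 * ENNReal.ofReal (l ^ (-p)) *
        ∫⁻ x, ENNReal.ofReal (gradNorm f x) ^ p * ω x := by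
  have hp0 : 0 < p := by linarith
  rcases le_or_gt p q with hpq | hpq
  · exact exists_lintegral_bvyFn_rpow_mul_le hn hγ hp hpq hnpq
  obtain ⟨C, hC⟩ := exists_bvyFn_le_mul_bvyFn n hγ hq hpq
  obtain ⟨K, hK⟩ := exists_lintegral_bvyFn_rpow_mul_le hn (γ := γ / q * p) (by positivity) hp
    le_rfl (by simp)
  refine ⟨C ^ p * K, fun f hf hfc l hl A ω hA hω hA1 => ?_⟩
  calc ∫⁻ x, bvyFn f γ q l x ^ p * ω x
      ≤ ∫⁻ x, (C : ℝ≥0∞) ^ p * (bvyFn f (γ / q * p) p l x ^ p * ω x) := by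
        refine lintegral_mono fun x => ?_
        rw [← mul_assoc, ← ENNReal.mul_rpow_of_nonneg _ _ hp0.le]
        gcongr
        exact hC f hf.continuous.measurable l x
    _ = (C : ℝ≥0∞) ^ p * ∫⁻ x, bvyFn f (γ / q * p) p l x ^ p * ω x :=
        lintegral_const_mul' _ _ (ENNReal.rpow_ne_top_of_nonneg hp0.le ENNReal.coe_ne_top)
    _ ≤ (C : ℝ≥0∞) ^ p * (K * A ^ 2 * ENNReal.ofReal (l ^ (-p)) *
        ∫⁻ x, ENNReal.ofReal (gradNorm f x) ^ p * ω x) := by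
        gcongr
        exact hK f hf hfc l hl A ω hA hω hA1
    _ = _ := by
        rw [ENNReal.coe_mul, ENNReal.coe_rpow_of_nonneg _ hp0.le]
        ring

end Reduction

/-! ### Associate spaces and the construction of weights. -/

/-- The norm of the associate space, for functions with values in `[0, ∞]`. -/
noncomputable def assocENN {n : ℕ} (Y : FunctionNorm n) (h : EuclideanSpace ℝ (Fin n) → ℝ≥0∞) :
    ℝ≥0∞ :=
  ⨆ (g : EuclideanSpace ℝ (Fin n) → ℂ) (_ : Mem Y g) (_ : Y g = 1), ∫⁻ x, h x * ‖g x‖ₑ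

section Associate

variable {n : ℕ} {Y : FunctionNorm n}

theorem associate_eq_assocENN (f : EuclideanSpace ℝ (Fin n) → ℂ) :
    associate Y f = assocENN Y (fun x => ‖f x‖ₑ) := by
  simp only [associate, assocENN, enorm_mul]

theorem assocENN_mono_ae {h₁ h₂ : EuclideanSpace ℝ (Fin n) → ℝ≥0∞}
    (hh : ∀ᵐ x, h₁ x ≤ h₂ x) : assocENN Y h₁ ≤ assocENN Y h₂ := by
  refine iSup_mono fun g => iSup_mono fun _ => iSup_mono fun _ => ?_
  refine lintegral_mono_ae ?_
  filter_upwards [hh] with x hx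
  gcongr

theorem assocENN_congr_ae {h₁ h₂ : EuclideanSpace ℝ (Fin n) → ℝ≥0∞}
    (hh : h₁ =ᵐ[volume] h₂) : assocENN Y h₁ = assocENN Y h₂ :=
  le_antisymm (assocENN_mono_ae hh.le) (assocENN_mono_ae hh.symm.le)

theorem assocENN_const_mul (a : ℝ≥0∞) (ha : a ≠ ∞) (h : EuclideanSpace ℝ (Fin n) → ℝ≥0∞) :
    assocENN Y (fun x => a * h x) = a * assocENN Y h := by
  simp only [assocENN, ENNReal.mul_iSup, mul_assoc, lintegral_const_mul' _ _ ha]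

theorem assocENN_tsum_le {ι : Type*} [Countable ι] {u : ι → EuclideanSpace ℝ (Fin n) → ℝ≥0∞}
    (hu : ∀ i, AEMeasurable (u i)) :
    assocENN Y (fun x => ∑' i, u i x) ≤ ∑' i, assocENN Y (u i) := by
  refine iSup_le fun g => iSup₂_le fun hg hg1 => ?_
  simp only [← ENNReal.tsum_mul_right]
  have hm : ∀ i, AEMeasurable fun x => u i x * ‖g x‖ₑ := fun i => (hu i).mul hg.1.enorm
  rw [lintegral_tsum hm]
  exact ENNReal.tsum_le_tsum fun i => le_iSup_of_le g (le_iSup₂_of_le hg hg1 le_rfl)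

theorem IsBallQuasiBanach.const_mul_mem (hY : IsBallQuasiBanach Y) (c : ℂ)
    {g : EuclideanSpace ℝ (Fin n) → ℂ} (hg : Mem Y g) : Mem Y (fun x => c * g x) :=
  ⟨hg.1.const_mul c, by
    rw [hY.smul c g hg]
    exact ENNReal.mul_lt_top enorm_lt_top hg.2⟩

/-- Hölder's inequality. -/
theorem lintegral_mul_enorm_le (hY : IsBallQuasiBanach Y)
    (h : EuclideanSpace ℝ (Fin n) → ℝ≥0∞) {g : EuclideanSpace ℝ (Fin n) → ℂ} (hg : Mem Y g) :
    ∫⁻ x, h x * ‖g x‖ₑ ≤ Y g * assocENN Y h := by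
  rcases eq_or_ne (Y g) 0 with h0 | h0
  · have h1 : ∫⁻ x, h x * ‖g x‖ₑ = ∫⁻ _ : EuclideanSpace ℝ (Fin n), 0 := by
      refine lintegral_congr_ae ?_
      filter_upwards [hY.eq_zero g hg.1 h0] with x hx
      simp [hx]
    rw [h1, lintegral_zero]
    exact zero_le
  · have ht := hg.2.ne
    have hr : 0 < (Y g).toReal := ENNReal.toReal_pos h0 ht
    set c : ℂ := (((Y g).toReal⁻¹ : ℝ) : ℂ) with hc
    have hcn : ‖c‖ₑ = (Y g)⁻¹ := by
      rw [hc, ← ofReal_norm, Complex.norm_real, Real.norm_of_nonneg (by positivity),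
        ENNReal.ofReal_inv_of_pos hr, ENNReal.ofReal_toReal ht]
    have h1 : Y (fun x => c * g x) = 1 := by
      rw [hY.smul c g hg, hcn, ENNReal.inv_mul_cancel h0 ht]
    have h2 : ∫⁻ x, h x * ‖c * g x‖ₑ ≤ assocENN Y h :=
      le_iSup_of_le (fun x => c * g x) (le_iSup₂_of_le (hY.const_mul_mem c hg) h1 le_rfl)
    have h3 : ∫⁻ x, h x * ‖c * g x‖ₑ = (Y g)⁻¹ * ∫⁻ x, h x * ‖g x‖ₑ := by
      rw [← lintegral_const_mul' _ _ (ENNReal.inv_ne_top.2 h0)]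
      refine lintegral_congr fun x => ?_
      rw [enorm_mul, hcn]
      ring
    rw [h3] at h2
    calc ∫⁻ x, h x * ‖g x‖ₑ = Y g * ((Y g)⁻¹ * ∫⁻ x, h x * ‖g x‖ₑ) := by
          rw [← mul_assoc, ENNReal.mul_inv_cancel h0 ht, one_mul]
      _ ≤ _ := by gcongr

theorem ae_of_forall_ae_ball {P : EuclideanSpace ℝ (Fin n) → Prop}
    (h : ∀ R : ℝ, 0 < R → ∀ᵐ x, x ∈ Metric.ball (0 : EuclideanSpace ℝ (Fin n)) R → P x) :
    ∀ᵐ x, P x := by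
  have h1 : ∀ᵐ x, ∀ k : ℕ, x ∈ Metric.ball (0 : EuclideanSpace ℝ (Fin n)) (k + 1) → P x :=
    ae_all_iff.2 fun k => h _ (by positivity)
  filter_upwards [h1] with x hx
  obtain ⟨k, hk⟩ := exists_nat_gt ‖x‖
  exact hx k (by rw [mem_ball_zero_iff]; linarith)

/-- Pairing with the indicator of a ball, which belongs to `Y`, shows that the function is
integrable on each ball. -/
theorem ae_lt_top_of_assocENN_ne_top (hY : IsBallQuasiBanach Y)
    {h : EuclideanSpace ℝ (Fin n) → ℝ≥0∞} (hm : AEMeasurable h) (hh : assocENN Y h ≠ ∞) :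
    ∀ᵐ x, h x < ∞ := by
  refine ae_of_forall_ae_ball fun R hR => ?_
  have hb := hY.ball_mem 0 R hR
  have h1 := (lintegral_mul_enorm_le hY h hb).trans_lt
    (ENNReal.mul_lt_top hb.2 hh.lt_top)
  filter_upwards [ae_lt_top' (hm.mul hb.1.enorm) h1.ne] with x hx hxB
  simpa [Set.indicator_of_mem hxB] using hx

/-- The maximal bound is assumed for complex functions only. A function of finite associate norm is
finite almost everywhere, hence agrees almost everywhere with a complex one, and the maximal
function ignores null sets. -/
theorem assocENN_maxAvg_le (hY : IsBallQuasiBanach Y) {A : ℝ≥0}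
    (hA : MaximalBoundedBy (associate Y) A) {h : EuclideanSpace ℝ (Fin n) → ℝ≥0∞}
    (hm : AEMeasurable h) (hh : assocENN Y h ≠ ∞) :
    assocENN Y (maxAvg h) ≤ A * assocENN Y h := by
  have hfin := ae_lt_top_of_assocENN_ne_top hY hm hh
  set g : EuclideanSpace ℝ (Fin n) → ℂ := fun x => ((h x).toReal : ℂ) with hg
  have hcoe : ∀ w : ℝ≥0∞, w < ∞ → ‖((w.toReal : ℝ) : ℂ)‖ₑ = w := fun w hw => by
    rw [← ofReal_norm, Complex.norm_real, Real.norm_of_nonneg ENNReal.toReal_nonneg,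
      ENNReal.ofReal_toReal hw.ne]
  have hgh : (fun x => ‖g x‖ₑ) =ᵐ[volume] h := by
    filter_upwards [hfin] with x hx using hcoe _ hx
  have hgm : AEMeasurable g := Complex.measurable_ofReal.comp_aemeasurable hm.ennreal_toReal
  have hga : associate Y g = assocENN Y h := by
    rw [associate_eq_assocENN, assocENN_congr_ae hgh]
  have h1 := hA g ⟨hgm, by rw [hga]; exact hh.lt_top⟩
  rw [hga, maximalFn_eq_maxAvg, maxAvg_congr_ae hgh, normENN] at h1
  split_ifs at h1 with hf
  · rw [associate_eq_assocENN] at h1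
    refine le_trans (assocENN_mono_ae ?_) h1
    filter_upwards [hf] with x hx using (hcoe _ hx).ge
  · exact absurd h1 (not_le.2 (ENNReal.mul_lt_top ENNReal.coe_lt_top hh.lt_top))

/-- The Rubio de Francia iteration algorithm. -/
theorem exists_weight_ge (hY : IsBallQuasiBanach Y) {A : ℝ≥0} (hA0 : 1 ≤ A)
    (hA : MaximalBoundedBy (associate Y) A) {h : EuclideanSpace ℝ (Fin n) → ℝ≥0∞}
    (hm : Measurable h) (hh : assocENN Y h ≤ 1) :
    ∃ ω : EuclideanSpace ℝ (Fin n) → ℝ≥0∞, Measurable ω ∧ (∀ x, h x ≤ ω x) ∧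
      (∀ x, maxAvg ω x ≤ (2 * A : ℝ≥0) * ω x) ∧ assocENN Y ω ≤ 2 := by
  have hAne : (A : ℝ≥0∞) ≠ 0 := by
    exact_mod_cast (zero_lt_one.trans_le hA0).ne'
  set B : ℝ≥0∞ := ((2 * A : ℝ≥0) : ℝ≥0∞) with hB
  have hB2 : B = 2 * A := by rw [hB, ENNReal.coe_mul, ENNReal.coe_ofNat]
  have hB0 : B ≠ 0 := by rw [hB2]; exact mul_ne_zero two_ne_zero hAne
  have hBt : B ≠ ∞ := ENNReal.coe_ne_top
  have hBi : B⁻¹ ≠ ∞ := ENNReal.inv_ne_top.2 hB0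
  set I : ℕ → EuclideanSpace ℝ (Fin n) → ℝ≥0∞ := fun k => maxAvg^[k] h with hI
  have hIm : ∀ k, Measurable (I k) := fun k => by
    cases k with
    | zero => exact hm
    | succ k => simp only [hI, Function.iterate_succ_apply']; exact measurable_maxAvg
  have hIsucc : ∀ k, maxAvg (I k) = I (k + 1) := fun k =>
    (Function.iterate_succ_apply' maxAvg k h).symm
  have hIA : ∀ k, assocENN Y (I k) ≤ (A : ℝ≥0∞) ^ k := fun k => by
    induction k with
    | zero => simpa [hI] using hh
    | succ k ih =>
      rw [← hIsucc]
      refine (assocENN_maxAvg_le hY hA (hIm k).aemeasurable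
        (ne_top_of_le_ne_top (by finiteness) ih)).trans ?_
      rw [pow_succ']
      gcongr
  have hterm : ∀ k, Measurable fun x => B⁻¹ ^ k * I k x := fun k => (hIm k).const_mul _
  -- The weight is `∑ M^k h / (2A)^k`. Its zeroth term is `h`, applying `M` shifts the series at the
  -- cost of `2A`, and the norms are dominated by `∑ 2^(-k) = 2`.
  refine ⟨fun x => ∑' k, B⁻¹ ^ k * I k x, Measurable.tsum hterm, fun x => ?_, fun x => ?_, ?_⟩
  · refine le_trans ?_ (ENNReal.le_tsum 0)
    simp [hI]
  · refine (maxAvg_tsum_le (fun k => (hterm k).aemeasurable) x).trans ?_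
    calc ∑' k, maxAvg (fun y => B⁻¹ ^ k * I k y) x
        = ∑' k, B * (B⁻¹ ^ (k + 1) * I (k + 1) x) := by
          congr! 2 with k
          rw [maxAvg_const_mul _ (ENNReal.pow_ne_top hBi), hIsucc, pow_succ']
          rw [← mul_assoc, ← mul_assoc, ENNReal.mul_inv_cancel hB0 hBt, one_mul]
      _ = B * ∑' k, B⁻¹ ^ (k + 1) * I (k + 1) x := ENNReal.tsum_mul_left
      _ ≤ B * ∑' k, B⁻¹ ^ k * I k x := by
          refine mul_le_mul' le_rfl ?_
          exact ENNReal.tsum_comp_le_tsum_of_injective (add_left_injective 1)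
            (fun k => B⁻¹ ^ k * I k x)
  · refine (assocENN_tsum_le fun k => (hterm k).aemeasurable).trans ?_
    calc ∑' k, assocENN Y (fun x => B⁻¹ ^ k * I k x)
        ≤ ∑' k, (2⁻¹ : ℝ≥0∞) ^ k := by
          refine ENNReal.tsum_le_tsum fun k => ?_
          rw [assocENN_const_mul _ (ENNReal.pow_ne_top hBi)]
          calc B⁻¹ ^ k * assocENN Y (I k) ≤ B⁻¹ ^ k * (A : ℝ≥0∞) ^ k := by
                gcongr; exact hIA k
            _ = (2⁻¹ : ℝ≥0∞) ^ k := by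
                rw [← mul_pow, hB2, ENNReal.mul_inv (Or.inr ENNReal.coe_ne_top)
                  (Or.inr hAne), mul_assoc, ENNReal.inv_mul_cancel hAne ENNReal.coe_ne_top,
                  mul_one]
      _ = 2 := by rw [ENNReal.tsum_geometric, ENNReal.one_sub_inv_two, inv_inv]

theorem maximalBoundedBy_mono {A B : ℝ≥0} (hAB : A ≤ B) (hA : MaximalBoundedBy Y A) :
    MaximalBoundedBy Y B := fun g hg => (hA g hg).trans (by gcongr)

/-- Adding `1` avoids showing that the infimum is attained, and also yields a bound that is at least
`1`, as the iteration requires. -/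
theorem MaximalBounded.maximalBoundedBy_opNorm_add_one (h : MaximalBounded Y) :
    MaximalBoundedBy Y (maximalOpNorm Y + 1) := by
  obtain ⟨A, hA, hlt⟩ := exists_lt_of_csInf_lt (s := {A : ℝ≥0 | MaximalBoundedBy Y A}) h
    (lt_add_of_pos_right (maximalOpNorm Y) one_pos)
  exact maximalBoundedBy_mono hlt.le hA

/-- Integrability of members of `Y` on balls says that a multiple of the indicator of a ball lies in
the unit ball of the associate space, so it is an admissible test function. -/
theorem ae_lt_top_of_forall_lintegral_le (hY : IsBallBanach Y)
    {h : EuclideanSpace ℝ (Fin n) → ℝ≥0∞} (hm : Measurable h) {D : ℝ≥0∞} (hD : D ≠ ∞)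
    (hh : ∀ φ : EuclideanSpace ℝ (Fin n) → ℝ≥0∞, Measurable φ → assocENN Y φ ≤ 1 →
      ∫⁻ x, h x * φ x ≤ D) : ∀ᵐ x, h x < ∞ := by
  refine ae_of_forall_ae_ball fun R hR => ?_
  obtain ⟨κ, hκ, hint⟩ := hY.integral_ball 0 R hR
  have hκ0 : (κ : ℝ≥0∞) ≠ 0 := by exact_mod_cast hκ.ne'
  set B := Metric.ball (0 : EuclideanSpace ℝ (Fin n)) R with hB
  have hBm : MeasurableSet B := measurableSet_ball
  set φ : EuclideanSpace ℝ (Fin n) → ℝ≥0∞ := fun x => (κ : ℝ≥0∞)⁻¹ * B.indicator 1 x with hφ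
  have hφm : Measurable φ := (measurable_one.indicator measurableSet_ball).const_mul _
  have hφ1 : assocENN Y φ ≤ 1 := by
    rw [hφ, assocENN_const_mul _ (ENNReal.inv_ne_top.2 hκ0)]
    refine ENNReal.inv_mul_le_iff hκ0 ENNReal.coe_ne_top |>.2 ?_
    refine iSup_le fun g => iSup₂_le fun hg hg1 => ?_
    calc ∫⁻ x, B.indicator 1 x * ‖g x‖ₑ = ∫⁻ x in B, ‖g x‖ₑ := by
          rw [← lintegral_indicator hBm]
          refine lintegral_congr fun x => ?_
          by_cases hx : x ∈ B <;> simp [hx]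
      _ ≤ κ * Y g := hint g hg
      _ = κ * 1 := by rw [hg1]
  have h1 := (hh φ hφm hφ1).trans_lt hD.lt_top
  filter_upwards [ae_lt_top (hm.mul hφm) h1.ne] with x hx hxB
  have h2 : h x * (κ : ℝ≥0∞)⁻¹ < ∞ := by simpa [hφ, Set.indicator_of_mem hxB] using hx
  by_contra h3
  rw [not_lt_top_iff] at h3
  rw [h3, ENNReal.top_mul (ENNReal.inv_ne_zero.2 ENNReal.coe_ne_top)] at h2
  exact h2.ne rfl

end Associate

/-! ### Truncations, which are bounded with bounded support and hence in `L²`. -/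

/-- Truncation of a function, in height and in space. -/
noncomputable def truncate {n : ℕ} (m : ℕ) (h : EuclideanSpace ℝ (Fin n) → ℝ)
    (x : EuclideanSpace ℝ (Fin n)) : ℝ :=
  (Metric.ball 0 (m + 1 : ℝ)).indicator (fun x => min (h x) m) x

section Truncate

variable {n : ℕ} {h : EuclideanSpace ℝ (Fin n) → ℝ}

theorem truncate_nonneg (hh : ∀ x, 0 ≤ h x) (m : ℕ) (x : EuclideanSpace ℝ (Fin n)) :
    0 ≤ truncate m h x :=
  Set.indicator_nonneg (fun x _ => le_min (hh x) (Nat.cast_nonneg m)) x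

theorem truncate_le (hh : ∀ x, 0 ≤ h x) (m : ℕ) (x : EuclideanSpace ℝ (Fin n)) :
    truncate m h x ≤ h x :=
  Set.indicator_le_self' (fun _ _ => hh _) x |>.trans' <|
    Set.indicator_le_indicator (min_le_left _ _)

theorem truncate_le_indicator (m : ℕ) (x : EuclideanSpace ℝ (Fin n)) :
    truncate m h x ≤ m * (Metric.ball (0 : EuclideanSpace ℝ (Fin n)) (m + 1)).indicator 1 x := by
  by_cases hx : x ∈ Metric.ball (0 : EuclideanSpace ℝ (Fin n)) (m + 1)
  · simp [truncate, Set.indicator_of_mem hx]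
  · simp [truncate, Set.indicator_of_notMem hx]

theorem monotone_truncate (hh : ∀ x, 0 ≤ h x) (x : EuclideanSpace ℝ (Fin n)) :
    Monotone fun m => truncate m h x := by
  intro m k hmk
  have hmk' : (m : ℝ) ≤ k := by exact_mod_cast hmk
  by_cases hx : x ∈ Metric.ball (0 : EuclideanSpace ℝ (Fin n)) (m + 1)
  · have hx' : x ∈ Metric.ball (0 : EuclideanSpace ℝ (Fin n)) (k + 1) :=
      Metric.ball_subset_ball (by linarith) hx
    simp only [truncate, Set.indicator_of_mem hx, Set.indicator_of_mem hx']
    exact min_le_min_left _ hmk'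
  · have : truncate m h x = 0 := Set.indicator_of_notMem hx _
    simp only [this]
    exact truncate_nonneg hh k x

theorem tendsto_truncate (h : EuclideanSpace ℝ (Fin n) → ℝ) (x : EuclideanSpace ℝ (Fin n)) :
    Tendsto (fun m => truncate m h x) atTop (𝓝 (h x)) := by
  obtain ⟨k, hk⟩ := exists_nat_ge (max ‖x‖ (h x))
  refine tendsto_const_nhds.congr' ?_
  filter_upwards [eventually_ge_atTop k] with m hm
  have hm' : (k : ℝ) ≤ m := by exact_mod_cast hm
  have h1 := le_max_left ‖x‖ (h x)
  have h2 := le_max_right ‖x‖ (h x)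
  rw [truncate, Set.indicator_of_mem (by rw [mem_ball_zero_iff]; linarith),
    min_eq_left (by linarith)]

theorem aemeasurable_truncate (hh : AEMeasurable h) (m : ℕ) : AEMeasurable (truncate m h) :=
  (hh.min aemeasurable_const).indicator measurableSet_ball

theorem memLp_two_of_le_indicator {F : EuclideanSpace ℝ (Fin n) → ℝ} (hF : AEMeasurable F)
    {C R : ℝ} (hFC : ∀ x, ‖F x‖ ≤
      C * (Metric.ball (0 : EuclideanSpace ℝ (Fin n)) R).indicator 1 x) : MemLp F 2 := by
  have h1 : MemLp ((Metric.ball (0 : EuclideanSpace ℝ (Fin n)) R).indicator fun _ => C) 2 :=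
    memLp_indicator_const 2 measurableSet_ball C (Or.inr measure_ball_lt_top.ne)
  refine h1.mono hF.aestronglyMeasurable (Eventually.of_forall fun x => ?_)
  refine (hFC x).trans ((le_abs_self _).trans_eq ?_)
  by_cases hx : x ∈ Metric.ball (0 : EuclideanSpace ℝ (Fin n)) R <;> simp [hx]

end Truncate

/-! ### The Lorentz--Luxemburg theorem by separation in `L²`. -/

section LorentzLuxemburg

variable {n : ℕ} {Y : FunctionNorm n}

theorem IsBallQuasiBanach.lattice_real (hY : IsBallQuasiBanach Y)
    {F G : EuclideanSpace ℝ (Fin n) → ℝ} (hF : AEMeasurable F) (hG : AEMeasurable G)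
    (h : ∀ᵐ x, |F x| ≤ |G x|) : Y (fun x => (F x : ℂ)) ≤ Y (fun x => (G x : ℂ)) := by
  refine hY.lattice _ _ (Complex.measurable_ofReal.comp_aemeasurable hG)
    (Complex.measurable_ofReal.comp_aemeasurable hF) ?_
  simpa using h

theorem IsBallQuasiBanach.mem_of_le_indicator (hY : IsBallQuasiBanach Y)
    {F : EuclideanSpace ℝ (Fin n) → ℝ} (hF : AEMeasurable F) {C R : ℝ} (hR : 0 < R)
    (hFC : ∀ x, ‖F x‖ ≤ C * (Metric.ball (0 : EuclideanSpace ℝ (Fin n)) R).indicator 1 x) :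
    Mem Y (fun x => (F x : ℂ)) := by
  have hFm : AEMeasurable fun x => (F x : ℂ) := Complex.measurable_ofReal.comp_aemeasurable hF
  have hb := hY.const_mul_mem C (hY.ball_mem 0 R hR)
  refine ⟨hFm, (hY.lattice _ _ hb.1 hFm (Eventually.of_forall fun x => ?_)).trans_lt hb.2⟩
  rw [Complex.norm_real]
  refine (hFC x).trans ((le_abs_self _).trans_eq ?_)
  by_cases hx : x ∈ Metric.ball (0 : EuclideanSpace ℝ (Fin n)) R <;> simp [hx]

/-- Lower semicontinuity of the norm under almost everywhere convergence. -/
theorem IsBallQuasiBanach.le_of_tendsto_ae (hY : IsBallQuasiBanach Y)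
    {u : ℕ → EuclideanSpace ℝ (Fin n) → ℝ} {F : EuclideanSpace ℝ (Fin n) → ℝ}
    (hu : ∀ k, AEMeasurable (u k)) (hF : AEMeasurable F)
    (hlim : ∀ᵐ x, Tendsto (fun k => u k x) atTop (𝓝 (F x))) {τ : ℝ≥0∞}
    (hτ : ∀ k, Y (fun x => (u k x : ℂ)) ≤ τ) : Y (fun x => (F x : ℂ)) ≤ τ := by
  -- The infima over tails increase to the absolute value of the limit, so the monotone Fatou
  -- property applies to them.
  set v : ℕ → EuclideanSpace ℝ (Fin n) → ℝ := fun m x => ⨅ k, |u (m + k) x| with hv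
  have hbdd : ∀ m x, BddBelow (Set.range fun k => |u (m + k) x|) := fun m x =>
    ⟨0, by rintro _ ⟨k, rfl⟩; exact abs_nonneg _⟩
  have hv0 : ∀ m x, 0 ≤ v m x := fun m x => le_ciInf fun k => abs_nonneg _
  have hvu : ∀ m x, v m x ≤ |u m x| := fun m x => ciInf_le (hbdd m x) 0
  have hvm : ∀ m, AEMeasurable (v m) := fun m =>
    AEMeasurable.iInf fun k => (hu (m + k)).abs
  have hmono : ∀ x, Monotone fun m => v m x := fun x m k hmk => by
    refine le_ciInf fun i => ?_
    have e : k + i = m + (k - m + i) := by omega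
    rw [e]
    exact ciInf_le (hbdd m x) (k - m + i)
  have h1 := hY.fatou v (fun x => |F x|) hvm hF.abs (by
    filter_upwards [hlim] with x hx
    refine ⟨fun m => hv0 m x, hmono x, ?_⟩
    refine Metric.tendsto_atTop.2 fun ε hε => ?_
    obtain ⟨N, hN⟩ := Metric.tendsto_atTop.1 hx.abs (ε / 2) (half_pos hε)
    refine ⟨N, fun m hm => ?_⟩
    have h2 : |F x| - ε / 2 ≤ v m x := le_ciInf fun k => by
      have := hN (m + k) (by omega)
      rw [Real.dist_eq, abs_lt] at this
      linarith
    have h3 := hvu m x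
    have h4 := hN m hm
    rw [Real.dist_eq, abs_lt] at h4 ⊢
    constructor <;> linarith)
  have h2 : Y (fun x => ((|F x| : ℝ) : ℂ)) ≤ τ := by
    refine le_of_tendsto' h1 fun m => (hY.lattice_real (hvm m) (hu m) ?_).trans (hτ m)
    refine Eventually.of_forall fun x => ?_
    rw [abs_of_nonneg (hv0 m x)]
    exact hvu m x
  refine (hY.lattice_real hF hF.abs (Eventually.of_forall fun x => ?_)).trans h2
  rw [abs_abs]

/-- The sublevel sets of the norm in `L²`. -/
def sublevelLp (Y : FunctionNorm n) (τ : ℝ≥0) :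
    Set (Lp ℝ 2 (volume : Measure (EuclideanSpace ℝ (Fin n)))) :=
  {F | Y (fun x => (F x : ℂ)) ≤ τ}

theorem aemeasurable_coe_Lp (F : Lp ℝ 2 (volume : Measure (EuclideanSpace ℝ (Fin n)))) :
    AEMeasurable F := (Lp.aestronglyMeasurable F).aemeasurable

/-- A sequence converging in `L²` has a subsequence converging almost everywhere, along which the
norm of `Y` is lower semicontinuous. -/
theorem isClosed_sublevelLp (hY : IsBallQuasiBanach Y) (τ : ℝ≥0) :
    IsClosed (sublevelLp Y τ) := by
  refine IsSeqClosed.isClosed fun u F hu hF => ?_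
  obtain ⟨ns, -, hns⟩ := (tendstoInMeasure_of_tendsto_Lp hF).exists_seq_tendsto_ae
  exact hY.le_of_tendsto_ae (fun k => aemeasurable_coe_Lp (u (ns k))) (aemeasurable_coe_Lp F) hns
    fun k => hu (ns k)

theorem convex_sublevelLp (hY : IsBallBanach Y) (τ : ℝ≥0) : Convex ℝ (sublevelLp Y τ) := by
  intro F hF G hG a b ha hb hab
  have hFm : Mem Y (fun x => (F x : ℂ)) :=
    ⟨Complex.measurable_ofReal.comp_aemeasurable (aemeasurable_coe_Lp F),
      lt_of_le_of_lt hF ENNReal.coe_lt_top⟩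
  have hGm : Mem Y (fun x => (G x : ℂ)) :=
    ⟨Complex.measurable_ofReal.comp_aemeasurable (aemeasurable_coe_Lp G),
      lt_of_le_of_lt hG ENNReal.coe_lt_top⟩
  have h1 := hY.add _ _ (hY.const_mul_mem a hFm) (hY.const_mul_mem b hGm)
  rw [hY.smul _ _ hFm, hY.smul _ _ hGm] at h1
  have hn : ∀ c : ℝ, 0 ≤ c → ‖(c : ℂ)‖ₑ = ENNReal.ofReal c := fun c hc => by
    rw [← ofReal_norm, Complex.norm_real, Real.norm_of_nonneg hc]
  have h2 : Y (fun x => ((a • F + b • G : Lp ℝ 2 volume) x : ℂ)) ≤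
      Y (fun x => (a : ℂ) * (F x : ℂ) + (b : ℂ) * (G x : ℂ)) := by
    refine hY.lattice _ _ ((hY.const_mul_mem a hFm).1.add (hY.const_mul_mem b hGm).1)
      (Complex.measurable_ofReal.comp_aemeasurable (aemeasurable_coe_Lp _)) ?_
    filter_upwards [Lp.coeFn_add (a • F) (b • G), Lp.coeFn_smul a F, Lp.coeFn_smul b G]
      with x h3 h4 h5
    rw [h3, Pi.add_apply, h4, h5]
    simp
  calc _ ≤ _ := h2
    _ ≤ _ := h1
    _ ≤ ENNReal.ofReal a * τ + ENNReal.ofReal b * τ := by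
        rw [hn a ha, hn b hb]
        gcongr
        · exact hF
        · exact hG
    _ = τ := by
        rw [← add_mul, ← ENNReal.ofReal_add ha hb, hab, ENNReal.ofReal_one, one_mul]

/-- If pairing with `φ ∈ L²` is bounded by `c` on a sublevel set of the norm of `Y`, then `φ`
belongs to the associate space. -/
theorem mul_assocENN_le_of_sublevelLp (hY : IsBallQuasiBanach Y) {τ : ℝ≥0} {c : ℝ}
    (φ : Lp ℝ 2 (volume : Measure (EuclideanSpace ℝ (Fin n))))
    (hφ : ∀ F ∈ sublevelLp Y τ, inner ℝ φ F ≤ c) :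
    τ * assocENN Y (fun x => ‖φ x‖ₑ) ≤ ENNReal.ofReal c := by
  have hτ0 : (0 : ℝ) ≤ τ := τ.coe_nonneg
  have hφm := aemeasurable_coe_Lp φ
  simp only [assocENN, ENNReal.mul_iSup]
  refine iSup_le fun g => iSup₂_le fun hg hg1 => ?_
  set a : EuclideanSpace ℝ (Fin n) → ℝ := fun x => ‖g x‖ with ha
  have ha0 : ∀ x, 0 ≤ a x := fun x => norm_nonneg _
  have ham : AEMeasurable a := hg.1.norm
  -- Test functions `τ · |g| · sign φ` with `|g|` truncated to be in `L²`; they stay in the sublevel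
  -- set because `Y g = 1`, and monotone convergence removes the truncation.
  set F : ℕ → EuclideanSpace ℝ (Fin n) → ℝ := fun m x =>
    τ * truncate m a x * (φ x / |φ x|) with hF
  have hFm : ∀ m, AEMeasurable (F m) := fun m =>
    ((aemeasurable_truncate ham m).const_mul _).mul (hφm.div hφm.abs)
  have hsign : ∀ x, abs (φ x / |φ x|) ≤ 1 := fun x => by
    rw [abs_div, abs_abs]
    exact div_self_le_one _
  have hFabs : ∀ m x, |F m x| ≤ τ * truncate m a x := fun m x => by
    have h0 : 0 ≤ τ * truncate m a x := mul_nonneg hτ0 (truncate_nonneg ha0 m x)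
    rw [hF, abs_mul, abs_of_nonneg h0]
    exact mul_le_of_le_one_right h0 (hsign x)
  have hFL : ∀ m, MemLp (F m) 2 := fun m => by
    refine memLp_two_of_le_indicator (C := τ * m) (R := m + 1) (hFm m) fun x => ?_
    refine (hFabs m x).trans ?_
    rw [mul_assoc]
    exact mul_le_mul_of_nonneg_left (truncate_le_indicator m x) hτ0
  have hFS : ∀ m, (hFL m).toLp (F m) ∈ sublevelLp Y τ := fun m => by
    have h1 := (hY.const_mul_mem ((τ : ℝ) : ℂ) hg)
    have h2 : Y (fun x => (((τ : ℝ) : ℂ)) * g x) = τ := by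
      rw [hY.smul _ _ hg, hg1, mul_one, ← ofReal_norm, Complex.norm_real,
        Real.norm_of_nonneg hτ0]
      exact ENNReal.ofReal_coe_nnreal
    change Y _ ≤ _
    rw [← h2]
    refine hY.lattice _ _ h1.1
      (Complex.measurable_ofReal.comp_aemeasurable (aemeasurable_coe_Lp _)) ?_
    filter_upwards [(hFL m).coeFn_toLp] with x hx
    rw [hx, Complex.norm_real, norm_mul (_ : ℂ), Complex.norm_real, Real.norm_of_nonneg hτ0]
    exact (hFabs m x).trans (mul_le_mul_of_nonneg_left (truncate_le ha0 m x) hτ0)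
  have hbound : ∀ m, ∫⁻ x, ENNReal.ofReal (τ * truncate m a x * |φ x|) ≤ ENNReal.ofReal c := by
    intro m
    have h1 : (fun x => inner ℝ (φ x) ((hFL m).toLp (F m) x)) =ᵐ[volume]
        fun x => τ * truncate m a x * |φ x| := by
      filter_upwards [(hFL m).coeFn_toLp] with x hx
      rw [hx, hF]
      simp only [RCLike.inner_apply, conj_trivial]
      rw [mul_assoc]
      congr 1
      rcases eq_or_ne (φ x) 0 with h0 | h0
      · simp [h0]
      · have : |φ x| ≠ 0 := abs_ne_zero.2 h0
        rw [div_mul_eq_mul_div, div_eq_iff this, abs_mul_abs_self]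
    have h2 := L2.integrable_inner (𝕜 := ℝ) φ ((hFL m).toLp (F m))
    have h3 := hφ _ (hFS m)
    rw [L2.inner_def, integral_congr_ae h1] at h3
    rw [← ofReal_integral_eq_lintegral_ofReal (h2.congr h1)]
    · exact ENNReal.ofReal_le_ofReal h3
    · exact Eventually.of_forall fun x =>
        mul_nonneg (mul_nonneg hτ0 (truncate_nonneg ha0 m x)) (abs_nonneg _)
  have hlim : Tendsto (fun m => ∫⁻ x, ENNReal.ofReal (τ * truncate m a x * |φ x|)) atTop
      (𝓝 (∫⁻ x, ENNReal.ofReal (τ * a x * |φ x|))) := by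
    refine lintegral_tendsto_of_tendsto_of_monotone (fun m => ?_) ?_ ?_
    · exact (((aemeasurable_truncate ham m).const_mul _).mul hφm.abs).ennreal_ofReal
    · refine Eventually.of_forall fun x m k hmk => ENNReal.ofReal_le_ofReal ?_
      exact mul_le_mul_of_nonneg_right
        (mul_le_mul_of_nonneg_left (monotone_truncate ha0 x hmk) hτ0) (abs_nonneg _)
    · refine Eventually.of_forall fun x => ENNReal.tendsto_ofReal ?_
      exact ((tendsto_truncate a x).const_mul _).mul_const _
  have h4 := le_of_tendsto' hlim hbound
  rw [← lintegral_const_mul' _ _ ENNReal.coe_ne_top]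
  refine le_trans (le_of_eq (lintegral_congr fun x => ?_)) h4
  rw [ENNReal.ofReal_mul (mul_nonneg hτ0 (ha0 x)), ENNReal.ofReal_mul hτ0,
    ← Real.norm_eq_abs, ofReal_norm, ofReal_norm, ENNReal.ofReal_coe_nnreal]
  ring

/-- The Lorentz--Luxemburg theorem: the norm of a nonnegative function is recovered from its
pairings with the unit ball of the associate space. -/
theorem IsBallBanach.le_of_forall_lintegral_le (hY : IsBallBanach Y)
    {h : EuclideanSpace ℝ (Fin n) → ℝ} (hm : Measurable h) (h0 : ∀ x, 0 ≤ h x) {t : ℝ≥0∞}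
    (ht : ∀ φ : EuclideanSpace ℝ (Fin n) → ℝ≥0∞, Measurable φ → assocENN Y φ ≤ 1 →
      ∫⁻ x, ENNReal.ofReal (h x) * φ x ≤ t) :
    Y (fun x => (h x : ℂ)) ≤ t := by
  have hlim := hY.fatou (fun m => truncate m h) h (fun m => aemeasurable_truncate hm.aemeasurable m)
    hm.aemeasurable (Eventually.of_forall fun x =>
      ⟨fun m => truncate_nonneg h0 m x, monotone_truncate h0 x, tendsto_truncate h x⟩)
  refine le_of_tendsto' hlim fun m => ?_
  -- If the norm of a truncation exceeds some `τ > t`, the truncation lies outside the closed convex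
  -- sublevel set at `τ` and is strictly separated from it; Riesz representation turns the
  -- functional into some `φ ∈ L²`.
  by_contra! hlt
  obtain ⟨τ, hτ1, hτ2⟩ := ENNReal.lt_iff_exists_nnreal_btwn.1 hlt
  have hHm := aemeasurable_truncate hm.aemeasurable m
  have hHL : MemLp (truncate m h) 2 := by
    refine memLp_two_of_le_indicator (C := m) (R := m + 1) hHm fun x => ?_
    rw [Real.norm_of_nonneg (truncate_nonneg h0 m x)]
    exact truncate_le_indicator m x
  set H := hHL.toLp with hH
  have hHS : H ∉ sublevelLp Y τ := by
    intro hmem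
    refine absurd (lt_of_lt_of_le hτ2 ?_) (not_lt.2 hmem)
    refine hY.lattice_real hHm (aemeasurable_coe_Lp H) ?_
    filter_upwards [hHL.coeFn_toLp] with x hx
    rw [hx]
  obtain ⟨ℓ, c, hc, hcH⟩ := geometric_hahn_banach_closed_point (convex_sublevelLp hY τ)
    (isClosed_sublevelLp hY.toIsBallQuasiBanach τ) hHS
  set φ := (InnerProductSpace.toDual ℝ _).symm ℓ with hφ
  have hℓ : ∀ F, ℓ F = inner ℝ φ F := fun F =>
    (InnerProductSpace.toDual_symm_apply (𝕜 := ℝ)).symm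
  have h0S : (0 : Lp ℝ 2 (volume : Measure (EuclideanSpace ℝ (Fin n)))) ∈ sublevelLp Y τ := by
    have hz : Mem Y (fun _ => 0) := by
      simpa using hY.const_mul_mem 0 (hY.ball_mem 0 1 one_pos)
    have h1 := hY.smul 0 _ hz
    simp only [zero_mul, enorm_zero] at h1
    have h2 : Y (fun x => ((0 : Lp ℝ 2 (volume : Measure (EuclideanSpace ℝ (Fin n)))) x : ℂ)) ≤
        Y (fun _ => 0) := by
      refine hY.lattice _ _ hz.1
        (Complex.measurable_ofReal.comp_aemeasurable (aemeasurable_coe_Lp _)) ?_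
      filter_upwards [Lp.coeFn_zero ℝ 2 (volume : Measure (EuclideanSpace ℝ (Fin n)))] with x hx
      simp
    exact h2.trans (h1.trans_le zero_le)
  have hc0 : 0 < c := by simpa using hc 0 h0S
  have hassoc := mul_assocENN_le_of_sublevelLp (c := c) hY.toIsBallQuasiBanach φ
    fun F hF => (hℓ F ▸ hc F hF).le
  have hcn0 : ENNReal.ofReal c ≠ 0 := (ENNReal.ofReal_pos.2 hc0).ne'
  have hφm := aemeasurable_coe_Lp φ
  set ψ : EuclideanSpace ℝ (Fin n) → ℝ≥0∞ := hφm.enorm.mk with hψ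
  have hψm : Measurable ψ := hφm.enorm.measurable_mk
  have hψe : (fun x => ‖φ x‖ₑ) =ᵐ[volume] ψ := hφm.enorm.ae_eq_mk
  -- This scaling puts `|φ|` into the unit ball of the associate space, while its pairing with `h`
  -- is at least `κ * c = τ > t`, a contradiction.
  set κ : ℝ≥0∞ := (ENNReal.ofReal c)⁻¹ * τ with hκ
  have hκt : κ ≠ ∞ := ENNReal.mul_ne_top (ENNReal.inv_ne_top.2 hcn0) ENNReal.coe_ne_top
  have h1 := ht (fun x => κ * ψ x) (hψm.const_mul κ) (by
    rw [assocENN_const_mul κ hκt, ← assocENN_congr_ae hψe, hκ, mul_assoc]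
    exact (ENNReal.inv_mul_le_iff hcn0 ENNReal.ofReal_ne_top).2 (by rwa [mul_one]))
  have h2 : ENNReal.ofReal c ≤ ∫⁻ x, ENNReal.ofReal (h x) * ψ x := by
    have h3 : c ≤ ∫ x, inner ℝ (φ x) (H x) := by
      rw [← L2.inner_def, ← hℓ]
      exact hcH.le
    have h4 := L2.integrable_inner (𝕜 := ℝ) φ H
    calc ENNReal.ofReal c ≤ ENNReal.ofReal (∫ x, inner ℝ (φ x) (H x)) :=
          ENNReal.ofReal_le_ofReal h3
      _ ≤ ‖∫ x, inner ℝ (φ x) (H x)‖ₑ := by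
          rw [← ofReal_norm]
          exact ENNReal.ofReal_le_ofReal (le_abs_self _)
      _ ≤ ∫⁻ x, ‖inner ℝ (φ x) (H x)‖ₑ := enorm_integral_le_lintegral_enorm _
      _ ≤ ∫⁻ x, ENNReal.ofReal (h x) * ψ x := by
          refine lintegral_mono_ae ?_
          filter_upwards [hψe, hHL.coeFn_toLp] with x hx1 hx2
          rw [← hx1, hx2]
          simp only [RCLike.inner_apply, conj_trivial]
          rw [enorm_mul]
          gcongr
          rw [← ofReal_norm, Real.norm_of_nonneg (truncate_nonneg h0 m x)]
          exact ENNReal.ofReal_le_ofReal (truncate_le h0 m x)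
  have h5 : ∫⁻ x, ENNReal.ofReal (h x) * (κ * ψ x) =
      κ * ∫⁻ x, ENNReal.ofReal (h x) * ψ x := by
    rw [← lintegral_const_mul' _ _ hκt]
    exact lintegral_congr fun x => by ring
  rw [h5] at h1
  have h6 : (τ : ℝ≥0∞) ≤ t := by
    calc (τ : ℝ≥0∞) = κ * ENNReal.ofReal c := by
          rw [hκ, mul_right_comm, ENNReal.inv_mul_cancel hcn0 ENNReal.ofReal_ne_top, one_mul]
      _ ≤ κ * ∫⁻ x, ENNReal.ofReal (h x) * ψ x := by gcongr
      _ ≤ t := h1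
  exact absurd hτ1 (not_lt.2 h6)

end LorentzLuxemburg

/-! ### Extrapolation to ball Banach function spaces. -/

section Conclusion

variable {n : ℕ} {X : FunctionNorm n}

theorem convexification_one_div_rpow {p : ℝ} (hp : 0 < p) {F : EuclideanSpace ℝ (Fin n) → ℝ}
    (hF : ∀ x, 0 ≤ F x) :
    convexification X (1 / p) (fun x => ((F x ^ p : ℝ) : ℂ)) = X (fun x => (F x : ℂ)) ^ p := by
  rw [convexification, one_div_one_div]
  congr 2
  funext x
  rw [Complex.norm_real, Real.norm_of_nonneg (Real.rpow_nonneg (hF x) p),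
    ← Real.rpow_mul (hF x), mul_one_div_cancel hp.ne', Real.rpow_one]

/-- A weighted estimate with Muckenhoupt weights of class `A₁` extrapolates to ball Banach function
spaces. -/
theorem normENN_rpow_le_of_weighted {p : ℝ} (hp : 0 < p) (hX : IsBallBanach X)
    (hY : IsBallBanach (convexification X (1 / p))) {A : ℝ≥0} (hA1 : 1 ≤ A)
    (hA : MaximalBoundedBy (associate (convexification X (1 / p))) A)
    {H : EuclideanSpace ℝ (Fin n) → ℝ≥0∞} (hH : Measurable H)
    {g : EuclideanSpace ℝ (Fin n) → ℝ} (hg : Continuous g) (hg0 : ∀ x, 0 ≤ g x)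
    (hgc : HasCompactSupport g) {D : ℝ≥0∞} (hD : D ≠ ∞)
    (hw : ∀ ω : EuclideanSpace ℝ (Fin n) → ℝ≥0∞, Measurable ω →
      (∀ x, maxAvg ω x ≤ (2 * A : ℝ≥0) * ω x) →
      ∫⁻ x, H x ^ p * ω x ≤ D * ∫⁻ x, ENNReal.ofReal (g x) ^ p * ω x) :
    normENN X H ^ p ≤ 2 * D * X (fun x => (g x : ℂ)) ^ p := by
  set Y := convexification X (1 / p) with hYdef
  have hYq := hY.toIsBallQuasiBanach
  have hgX : Mem X (fun x => (g x : ℂ)) := by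
    obtain ⟨M, hM⟩ := hgc.exists_bound_of_continuous hg
    obtain ⟨R, hR, hsub⟩ := hgc.isBounded.subset_ball_lt 0 0
    refine hX.toIsBallQuasiBanach.mem_of_le_indicator hg.measurable.aemeasurable hR (C := M)
      fun x => ?_
    by_cases hx : x ∈ Metric.ball (0 : EuclideanSpace ℝ (Fin n)) R
    · simpa [hx] using hM x
    · have : g x = 0 := image_eq_zero_of_notMem_tsupport fun h => hx (hsub h)
      simp [hx, this]
  have hgY : Mem Y (fun x => ((g x ^ p : ℝ) : ℂ)) := by
    refine ⟨(Complex.measurable_ofReal.comp (hg.measurable.pow_const p)).aemeasurable, ?_⟩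
    rw [hYdef, convexification_one_div_rpow hp hg0]
    exact ENNReal.rpow_lt_top_of_nonneg hp.le hgX.2.ne
  set D' := 2 * D * X (fun x => (g x : ℂ)) ^ p with hD'
  have hD't : D' ≠ ∞ := ENNReal.mul_ne_top (ENNReal.mul_ne_top (by simp) hD)
    (ENNReal.rpow_ne_top_of_nonneg hp.le hgX.2.ne)
  have hpair : ∀ φ : EuclideanSpace ℝ (Fin n) → ℝ≥0∞, Measurable φ → assocENN Y φ ≤ 1 →
      ∫⁻ x, H x ^ p * φ x ≤ D' := by
    intro φ hφ hφ1
    obtain ⟨ω, hωm, hφω, hωA, hω2⟩ := exists_weight_ge hYq hA1 hA hφ hφ1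
    calc ∫⁻ x, H x ^ p * φ x ≤ ∫⁻ x, H x ^ p * ω x :=
          lintegral_mono fun x => by gcongr; exact hφω x
      _ ≤ D * ∫⁻ x, ENNReal.ofReal (g x) ^ p * ω x := hw ω hωm hωA
      _ = D * ∫⁻ x, ω x * ‖((g x ^ p : ℝ) : ℂ)‖ₑ := by
          congr 2
          funext x
          rw [← ofReal_norm, Complex.norm_real, Real.norm_of_nonneg (Real.rpow_nonneg (hg0 x) p),
            ENNReal.ofReal_rpow_of_nonneg (hg0 x) hp.le, mul_comm]
      _ ≤ D * (Y (fun x => ((g x ^ p : ℝ) : ℂ)) * assocENN Y ω) := by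
          gcongr
          exact lintegral_mul_enorm_le hYq ω hgY
      _ ≤ D * (X (fun x => (g x : ℂ)) ^ p * 2) := by
          rw [hYdef, convexification_one_div_rpow hp hg0]
          gcongr
      _ = D' := by rw [hD']; ring
  -- Finiteness almost everywhere must come first, since `normENN` is infinite otherwise; this is
  -- where `D' ≠ ∞` enters.
  have hfinp := ae_lt_top_of_forall_lintegral_le hY (hH.pow_const p) hD't hpair
  have hfin : ∀ᵐ x, H x < ∞ := by
    filter_upwards [hfinp] with x hx
    exact (ENNReal.rpow_lt_top_iff_of_pos hp).1 hx
  rw [normENN, if_pos hfin, ← convexification_one_div_rpow hp fun x => ENNReal.toReal_nonneg]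
  refine hY.le_of_forall_lintegral_le (hH.ennreal_toReal.pow_const p)
    (fun x => Real.rpow_nonneg ENNReal.toReal_nonneg p) fun φ hφ hφ1 => ?_
  refine le_trans (lintegral_mono fun x => ?_) (hpair φ hφ hφ1)
  gcongr
  rw [← ENNReal.ofReal_rpow_of_nonneg ENNReal.toReal_nonneg hp.le]
  gcongr
  exact ENNReal.ofReal_toReal_le

end Conclusion

end BVY

theorem mainTheorem4 (n : ℕ) (hn : 1 ≤ n) (γ p q : ℝ) (hγ : 0 < γ) (hp : 1 ≤ p) (hq : 0 < q)
    (hpq : (n : ℝ) * (1 / p - 1 / q) < 1) :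
    ∃ C : ℝ → ℝ, (∀ t : ℝ, 0 < t → 0 < C t) ∧ ContinuousOn C (Set.Ioi 0) ∧
      StrictMonoOn C (Set.Ioi 0) ∧
      ∀ X : BVY.FunctionNorm n, BVY.IsBallBanach X →
        BVY.IsBallBanach (BVY.convexification X (1 / p)) →
        BVY.MaximalBounded (BVY.associate (BVY.convexification X (1 / p))) →
        ∀ f : EuclideanSpace ℝ (Fin n) → ℂ, ContDiff ℝ 1 f →
          HasCompactSupport (BVY.gradNorm f) →
          ⨆ (l : ℝ) (_ : 0 < l), ENNReal.ofReal l * BVY.normENN X (BVY.bvyFn f γ q l) ≤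
            ENNReal.ofReal
                (C (BVY.maximalOpNorm (BVY.associate (BVY.convexification X (1 / p))))) *
              X (fun x => (BVY.gradNorm f x : ℂ)) := by
  have hp0 : 0 < p := by linarith
  obtain ⟨K, hK⟩ := BVY.exists_lintegral_bvyFn_rpow_mul_le' hn hγ hp hq hpq
  have hbase : ∀ t : ℝ, 0 ≤ t → 0 < 8 * ((K : ℝ) + 1) * (t + 1) ^ 2 := fun t ht => by positivity
  -- With the weight constant `2 * (t + 1)` produced by the iteration, and the factor `2` from the
  -- norm of the weight, the `p`-th power of the constant is `2 * K * (2 * (t + 1)) ^ 2`. Replacing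
  -- `K` by `K + 1` ensures positivity and strict monotonicity.
  refine ⟨fun t => (8 * (K + 1) * (t + 1) ^ 2) ^ (1 / p), fun t ht => ?_, ?_, ?_, ?_⟩
  · exact Real.rpow_pos_of_pos (hbase t ht.le) _
  · exact ContinuousOn.rpow_const (by fun_prop) fun t ht => Or.inl (hbase t (le_of_lt ht)).ne'
  · intro s hs t ht hst
    have hs' : 0 < s := hs
    refine Real.rpow_lt_rpow (hbase s hs'.le).le ?_ (by positivity)
    gcongr
  intro X hX hY hM f hf hfc
  refine iSup₂_le fun l hl => ?_
  set a := BVY.maximalOpNorm (BVY.associate (BVY.convexification X (1 / p))) with ha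
  have hA := hM.maximalBoundedBy_opNorm_add_one
  rw [← ha] at hA
  have hA1 : 1 ≤ a + 1 := le_add_of_nonneg_left zero_le
  have hA2 : 1 ≤ 2 * (a + 1) := hA1.trans (le_mul_of_one_le_left zero_le one_le_two)
  set D : ℝ≥0∞ := K * ((2 * (a + 1) : ℝ≥0) : ℝ≥0∞) ^ 2 * ENNReal.ofReal (l ^ (-p)) with hD
  have hDt : D ≠ ∞ := by finiteness
  have key := BVY.normENN_rpow_le_of_weighted hp0 hX hY hA1 hA
    (BVY.measurable_bvyFn hf.continuous.measurable γ q l) (BVY.continuous_gradNorm hf)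
    BVY.gradNorm_nonneg hfc hDt fun ω hω hωA => hK f hf hfc l hl _ ω hA2 hω hωA
  set N := BVY.normENN X (BVY.bvyFn f γ q l)
  set G := X (fun x => (BVY.gradNorm f x : ℂ))
  have hconst : ENNReal.ofReal (l ^ p) * (2 * D) ≤
      ENNReal.ofReal (8 * (K + 1) * ((a : ℝ) + 1) ^ 2) := by
    have e : D = ENNReal.ofReal (K * (2 * (a + 1)) ^ 2 * l ^ (-p)) := by
      rw [hD, ENNReal.ofReal_mul (by positivity), ENNReal.ofReal_mul (by positivity),
        ENNReal.ofReal_coe_nnreal, ENNReal.ofReal_pow (by positivity)]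
      congr 3
      rw [← ENNReal.ofReal_coe_nnreal]
      push_cast
      rfl
    rw [e, ← ENNReal.ofReal_ofNat 2, ← ENNReal.ofReal_mul (by norm_num),
      ← ENNReal.ofReal_mul (by positivity)]
    refine ENNReal.ofReal_le_ofReal ?_
    have e2 : l ^ p * l ^ (-p) = 1 := by rw [← Real.rpow_add hl]; simp
    calc l ^ p * (2 * (K * (2 * ((a : ℝ) + 1)) ^ 2 * l ^ (-p)))
        = 8 * K * ((a : ℝ) + 1) ^ 2 * (l ^ p * l ^ (-p)) := by ring
      _ = 8 * K * ((a : ℝ) + 1) ^ 2 := by rw [e2, mul_one]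
      _ ≤ 8 * (K + 1) * ((a : ℝ) + 1) ^ 2 := by gcongr; linarith
  refine (ENNReal.rpow_le_rpow_iff hp0).1 ?_
  rw [ENNReal.mul_rpow_of_nonneg _ _ hp0.le, ENNReal.mul_rpow_of_nonneg _ _ hp0.le,
    ENNReal.ofReal_rpow_of_pos hl,
    ENNReal.ofReal_rpow_of_nonneg (Real.rpow_nonneg (hbase a a.2).le _) hp0.le,
    ← Real.rpow_mul (hbase a a.2).le, one_div_mul_cancel hp0.ne', Real.rpow_one]
  calc ENNReal.ofReal (l ^ p) * N ^ p ≤ ENNReal.ofReal (l ^ p) * (2 * D * G ^ p) := by gcongr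
    _ = ENNReal.ofReal (l ^ p) * (2 * D) * G ^ p := by ring
    _ ≤ _ := by gcongr
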